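/- **Model.** Let $U^1,U^2,\dots$ be i.i.d. centered Gaussian vectors in $\mathbb R^n$ whose covariance matrix $\Sigma_S$ has unit diagonal, entries $\rho>0$ at positions $(i,j)$ with $i\ne j$, $i,j\in S$, and entries $0$ elsewhere. One tests $H_0: S=\emptyset$ against $H_1: S\in\mathcal D_{[k]}$, where $k$ divides $n$ and $\mathcal D_{[k]}=\{I_1,\dots,I_{n/k}\}$, $I_j=\{(j-1)k+1,\dots,jk\}$. An adaptive testing procedure with budget $M$ chooses, at each round $t\le M$, a query set $A^t\subseteq[n]$ as a measurable function of the queries and observations of the earlier rounds, observes the coordinates of $U^t$ in $A^t$, respects $\sum_{t}|A^t|\le M$, and ends with a measurable test $\phi\in\{0,1\}$ of the whole history. Its risk is $\mathbb P_\emptyset(\phi=1)+\max_{S\in\mathcal D_{[k]}}\mathbb P_S(\phi=0)$. Put $m=M/n$. **Modified sequential thresholding.** Fix $\varepsilon>0$. Let $\tilde n=n/k$, $p=\min(k,\lceil 1/\rho\rceil)$ (so $p=\lceil1/\rho\rceil$ if $\rho k\ge1$ and $p=k$ if $\rho k<1$), $\tilde m=\lfloor mk/p\rfloor$, $\bar m=\lfloor\tilde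 m/4\rfloor$, and $K=\lfloor(1+\varepsilon)\log_2\tilde n\rfloor$. Let $f_0$ and $f_1$ be the densities of the centered Gaussian laws on $\mathbb R^p$ with covariance the identity, respectively the matrix with unit diagonal and off-diagonal entries $\rho$. For $z^1,\dots,z^{\bar m}\in\mathbb R^p$ let $LR(z)=\prod_t f_1(z^t)/\prod_t f_0(z^t)$, and let $\gamma$ be the median of $LR$ when the $z^t$ are i.i.d. with density $f_0$. Start with $\mathcal S_0=\{1,\dots,\tilde n\}$. At step $r=1,\dots,K$ observe, in $\bar m$ new rounds, the first $p$ coordinates of every interval $I_j$ with $j\in\mathcal S_{r-1}$, and let $\mathcal S_r$ be the set of those $j\in\mathcal S_{r-1}$ for which the likelihood ratio of these $\bar m$ observations exceeds $\gamma$; if $\sum_{s=0}^{r}|\mathcal S_s|>4\tilde n$, stop and do not reject. If the procedure has not stopped early, reject $H_0$ if and only if $\mathcal S_K\neq\emptyset$. **Proposition.** There exist numerical constants $C_5,C_6>0$ such that the following holds for every $\varepsilon>0$. Let $n,k,M,\rho$ vary along a sequence with $k\mid n$, $\rho>0$, $n\to\infty$, $k\to\infty$, $k/n\to0$ and $\rho\to0$.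 Suppose that either $$\rho k\to\infty\quad\text{and eventually}\quad \rho k m\ge C_5\log\log(n/k),$$ or $$\rho k\to0\quad\text{and eventually}\quad \rho k\sqrt m\ge C_6\sqrt{\log\log(n/k)}.$$ Then the modified sequential thresholding procedure for disjoint $k$-intervals is an adaptive testing procedure with budget $M$, and its risk converges to zero. -/

import Mathlib

open MeasureTheory ProbabilityTheory Filter Topology
open scoped ENNReal

noncomputable section

namespace CorrDetect

/-! ### The correlation model -/

/-- The covariance matrix with unit diagonal, off-diagonal entries `ρ` inside `S`,
and zeros elsewhere. -/
def corrMatrix {n : ℕ} (ρ : ℝ) (S : Finset (Fin n)) : Matrix (Fin n) (Fin n) ℝ :=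
  Matrix.of fun i j => if i = j then 1 else if i ∈ S ∧ j ∈ S then ρ else 0

/-- The centered Gaussian law of one sample vector `U^t` with contaminated set `S`
(`S = ∅` is the null hypothesis). -/
def sampleLaw {n : ℕ} (ρ : ℝ) (S : Finset (Fin n)) : Measure (EuclideanSpace ℝ (Fin n)) :=
  multivariateGaussian 0 (corrMatrix ρ S)

/-- `{jk, …, jk + d - 1}`: the first `d` coordinates of the `j`-th block of length `k`
(blocks and coordinates are numbered from `0`). For `d = k` it is the whole block. -/
def block (n k d j : ℕ) : Finset (Fin n) :=
  Finset.univ.filter fun i => j * k ≤ (i : ℕ) ∧ (i : ℕ) < j * k + d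

/-- The class of disjoint `k`-intervals. -/
def disjointIntervals (n k : ℕ) : Set (Finset (Fin n)) :=
  Set.range fun j : Fin (n / k) => block n k k j

/-! ### Adaptive sensing and testing -/

/-- What is recorded in one round: the query `A^t` and the observation `X^t`. -/
abbrev Obs (n : ℕ) : Type := Finset (Fin n) × EuclideanSpace ℝ (Fin n)

/-- The vector that agrees with `u` on `A` and vanishes off `A`. -/
def mask {n : ℕ} (A : Finset (Fin n)) (u : EuclideanSpace ℝ (Fin n)) :
    EuclideanSpace ℝ (Fin n) :=
  WithLp.toLp 2 fun i => if i ∈ A then u i else 0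

/-- A testing procedure with `M` rounds and without additional randomization: the query of
round `t` is a function of the history of the rounds before `t`, and the test is a function of
the whole history (`true` means that the null hypothesis is rejected). -/
structure AdaptiveProcedure (n M : ℕ) where
  query : (t : Fin M) → (Fin t → Obs n) → Finset (Fin n)
  test : (Fin M → Obs n) → Bool

namespace AdaptiveProcedure

variable {n M : ℕ}

/-- The history `(A^t, X^t)_t` produced by a procedure on the sample vectors `u`. -/
def history (π : AdaptiveProcedure n M) (u : Fin M → EuclideanSpace ℝ (Fin n)) (t : Fin M) :
    Obs n :=
  let A := π.query t fun s : Fin t => history π u ⟨s, s.2.trans t.2⟩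
  (A, mask A (u t))
termination_by t.val
decreasing_by exact s.2

/-- Queries and test are measurable, and the total number of queried coordinates never exceeds
the budget `M`. -/
structure IsAdmissible (π : AdaptiveProcedure n M) : Prop where
  measurable_query : ∀ t, Measurable (π.query t)
  measurable_test : Measurable π.test
  budget : ∀ u, ∑ t, (π.history u t).1.card ≤ M

/-- The worst-case risk over the class `C`: probability of type I error plus the largest
probability of type II error, the sample vectors being i.i.d. -/
def risk (π : AdaptiveProcedure n M) (ρ : ℝ) (C : Set (Finset (Fin n))) : ℝ≥0∞ :=
  Measure.pi (fun _ : Fin M => sampleLaw ρ (∅ : Finset (Fin n)))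
      {u | π.test (π.history u) = true} +
    ⨆ S ∈ C, Measure.pi (fun _ : Fin M => sampleLaw ρ S) {u | π.test (π.history u) = false}

end AdaptiveProcedure

/-! ### Sequential thresholding for independent vector-valued rows -/

/-- The density of the centered Gaussian law with (positive definite) covariance `V` with
respect to Lebesgue measure. -/
def gaussianDensity {d : ℕ} (V : Matrix (Fin d) (Fin d) ℝ) (x : EuclideanSpace ℝ (Fin d)) : ℝ :=
  (√((2 * Real.pi) ^ d * V.det))⁻¹ *
    Real.exp (-(dotProduct (fun i => x i) (V⁻¹.mulVec fun i => x i)) / 2)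

/-- The likelihood ratio of `q` observations of one row. -/
def likelihoodRatio {d q : ℕ} (f₀ f₁ : EuclideanSpace ℝ (Fin d) → ℝ)
    (z : Fin q → EuclideanSpace ℝ (Fin d)) : ℝ :=
  (∏ t, f₁ (z t)) / ∏ t, f₀ (z t)

/-- The (lower) median of a probability measure on the line. -/
def median (μ : Measure ℝ) : ℝ := sInf {x | 1 / 2 ≤ μ (Set.Iic x)}

/-- The rows `𝒮_r` that remain after `r` steps, out of `N` rows: `z s i` is the `s`-th
observation of row `i`, step `r` uses the `r`-th batch of `q` observations, `L` is the
statistic and `γ` the threshold. -/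
def survivors {N d : ℕ} (q : ℕ) (L : (Fin q → EuclideanSpace ℝ (Fin d)) → ℝ) (γ : ℝ)
    (z : ℕ → Fin N → EuclideanSpace ℝ (Fin d)) : ℕ → Finset (Fin N)
  | 0 => Finset.univ
  | r + 1 => (survivors q L γ z r).filter fun i => γ < L fun t => z (r * q + (t : ℕ)) i

/-- Early termination by the end of step `r`: measuring all the sets `𝒮_0, …, 𝒮_r`, `q` times
each row, would exceed the row budget `4qN`. (The sum increases with `r`, so that a procedure
that has terminated stays so.) -/
def Terminated {N : ℕ} (𝒮 : ℕ → Finset (Fin N)) (r : ℕ) : Prop :=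
  4 * N < ∑ s ∈ Finset.range (r + 1), (𝒮 s).card

/-- The number of steps, `⌊(1 + ε) log₂ N⌋`. -/
def numSteps (ε : ℝ) (N : ℕ) : ℕ := ⌊(1 + ε) * Real.logb 2 N⌋₊

/-! ### Modified sequential thresholding for disjoint intervals -/

/-- The observations recorded in a history of `T` rounds, continued by zero. -/
def padded {n T : ℕ} (h : Fin T → Obs n) (s : ℕ) : EuclideanSpace ℝ (Fin n) :=
  if hs : s < T then (h ⟨s, hs⟩).2 else 0

/-- The first `d` coordinates of the `j`-th block of length `k` of `x`. -/
def row {n : ℕ} (k d : ℕ) (x : EuclideanSpace ℝ (Fin n)) (j : ℕ) : EuclideanSpace ℝ (Fin d) :=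
  WithLp.toLp 2 fun i => if h : j * k + (i : ℕ) < n then x ⟨j * k + (i : ℕ), h⟩ else 0

/-- The number of coordinates kept per interval: `⌈1/ρ⌉`, clamped to the length `k`. -/
def keep (k : ℕ) (ρ : ℝ) : ℕ := min k ⌈1 / ρ⌉₊

/-- The size of one batch: a quarter of the number `⌊M / (N d)⌋ = ⌊mk / d⌋` of times that all
`N = n / k` truncated intervals of `d` coordinates could be measured, where `m = M / n`. -/
def batch (n k M d : ℕ) : ℕ := M / (n / k * d) / 4

/-- The threshold: the median under the null of the likelihood ratio of a batch of `q`
observations of `d` coordinates of an interval. -/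
def threshold (d q : ℕ) (ρ : ℝ) : ℝ :=
  median ((Measure.pi fun _ : Fin q => sampleLaw ρ (∅ : Finset (Fin d))).map
    (likelihoodRatio (gaussianDensity (corrMatrix ρ (∅ : Finset (Fin d))))
      (gaussianDensity (corrMatrix ρ (Finset.univ : Finset (Fin d))))))

/-- The intervals that remain after `r` steps, as determined by the observations `x`. -/
def stSurvivors {n : ℕ} (k d q : ℕ) (ρ : ℝ) (x : ℕ → EuclideanSpace ℝ (Fin n)) :
    ℕ → Finset (Fin (n / k)) :=
  survivors q
    (likelihoodRatio (gaussianDensity (corrMatrix ρ (∅ : Finset (Fin d))))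
      (gaussianDensity (corrMatrix ρ (Finset.univ : Finset (Fin d)))))
    (threshold d q ρ) (fun s i => row k d (x s) i)

open Classical in
/-- The modified sequential thresholding procedure for disjoint `k`-intervals. Rounds are
numbered from `0`. With batches of size `q`, round `t` belongs to the step numbered `t / q`,
and queries the kept coordinates of all the intervals that remain, unless all steps have been
carried out or the procedure has terminated. -/
def modifiedST (n k M : ℕ) (ρ ε : ℝ) : AdaptiveProcedure n M where
  query t h :=
    let d := keep k ρ
    let q := batch n k M d
    let 𝒮 := stSurvivors k d q ρ (padded h)
    if (t : ℕ) < numSteps ε (n / k) * q ∧ ¬ Terminated 𝒮 ((t : ℕ) / q) then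
      (𝒮 ((t : ℕ) / q)).biUnion fun j => block n k d j
    else ∅
  test h :=
    let d := keep k ρ
    let q := batch n k M d
    let 𝒮 := stSurvivors k d q ρ (padded h)
    let K := numSteps ε (n / k)
    decide (¬ Terminated 𝒮 K ∧ (𝒮 K).Nonempty)

end CorrDetect

end

/-! Each step compares a row, that is the kept coordinates of one interval, with the median of the
null likelihood ratio. An uncontaminated row therefore survives a step with probability at most 1/2.
Write N for the number of intervals, K for the number of steps and q for the batch size. The risk
splits into three errors (`risk_modifiedST_le`). Under the null, a union bound leaves a survivor
after K steps with probability at most N 2^(-K) ≤ 2 N^(-ε). Under the alternative, the survival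
times of the uncontaminated rows are independent with bounded mean and variance, so Chebyshev's
inequality makes early termination unlikely (`measure_lt_sum_card_le`). Finally, the contaminated
row is lost with probability at most 2 K b^q, where b is the squared Hellinger affinity of the two
row laws (`measure_likelihoodRatio_le_median_le`).

An explicit determinant gives b ≤ exp(-x²/32) with x = (d - 1)ρ ≤ 2, for d kept coordinates
(`sqAffinity_le`). If ρk is large, keeping about 1/ρ coordinates makes x of constant order and q of
order ρkm; if ρk is small, d = k makes x of order ρk and q of order m. In both regimes the signal
condition yields b^q ≤ e / (log N)², which beats K = O(log N).

The independence arguments need the full samples, whereas the procedure sees masked ones. Surviving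
rows are observed entirely until termination, so both versions lead to the same decision
(`modifiedST_test_history`). -/

namespace CorrDetect

/-! ### Gaussian integrals of exponentials of quadratic forms. -/

section GaussianIntegrals

open scoped MatrixOrder RealInnerProductSpace

variable {ι : Type*} [Fintype ι]

/-- Both measures are finite and have the same characteristic function, by the Fourier transform of
the Gaussian. -/
lemma stdGaussian_eq_withDensity :
    stdGaussian (EuclideanSpace ℝ ι) = volume.withDensity fun x =>
      ENNReal.ofReal ((2 * Real.pi) ^ (-(Fintype.card ι / 2 : ℝ)) * Real.exp (-‖x‖ ^ 2 / 2)) := by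
  have hnn : ∀ x : EuclideanSpace ℝ ι,
      0 ≤ (2 * Real.pi) ^ (-(Fintype.card ι / 2 : ℝ)) * Real.exp (-‖x‖ ^ 2 / 2) := fun x => by
    positivity
  have hint : Integrable (fun x : EuclideanSpace ℝ ι =>
      (2 * Real.pi) ^ (-(Fintype.card ι / 2 : ℝ)) * Real.exp (-‖x‖ ^ 2 / 2)) := by
    refine Integrable.const_mul ?_ _
    have := GaussianFourier.integrable_cexp_neg_mul_sq_norm_add (V := EuclideanSpace ℝ ι)
      (b := 1 / 2) (by norm_num) 0 0
    refine this.norm.congr (ae_of_all _ fun x => ?_)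
    simp only [Complex.norm_exp]
    congr 1
    simp [← Complex.ofReal_pow]
    ring
  have : IsFiniteMeasure (volume.withDensity fun x : EuclideanSpace ℝ ι =>
      ENNReal.ofReal ((2 * Real.pi) ^ (-(Fintype.card ι / 2 : ℝ)) * Real.exp (-‖x‖ ^ 2 / 2))) :=
    isFiniteMeasure_withDensity_ofReal hint.2
  apply Measure.ext_of_charFun
  ext t
  rw [charFun_stdGaussian, charFun_apply, integral_withDensity_eq_integral_toReal_smul
    (by fun_prop) (ae_of_all _ fun _ => ENNReal.ofReal_lt_top)]
  simp_rw [ENNReal.toReal_ofReal (hnn _)]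
  have h := GaussianFourier.integral_cexp_neg_mul_sq_norm_add_of_euclideanSpace (ι := ι)
    (b := 1 / 2) (by norm_num) Complex.I t
  have h2 : ∀ x : EuclideanSpace ℝ ι,
      ((2 * Real.pi) ^ (-(Fintype.card ι / 2 : ℝ)) * Real.exp (-‖x‖ ^ 2 / 2)) •
        Complex.exp (⟪x, t⟫ * Complex.I) = ((2 * Real.pi) ^ (-(Fintype.card ι / 2 : ℝ)) : ℝ) *
        Complex.exp (-(1 / 2) * ‖x‖ ^ 2 + Complex.I * ⟪t, x⟫) := fun x => by
    rw [Complex.real_smul, Complex.ofReal_mul, mul_assoc, Complex.ofReal_exp, ← Complex.exp_add,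
      real_inner_comm]
    congr 2
    push_cast
    ring
  simp_rw [h2]
  rw [integral_const_mul, h]
  have h3 : (Real.pi / (1 / 2) : ℂ) ^ (Fintype.card ι / 2 : ℂ) =
      ((2 * Real.pi) ^ (Fintype.card ι / 2 : ℝ) : ℝ) := by
    rw [Complex.ofReal_cpow (by positivity)]
    congr 1 <;> push_cast <;> ring
  rw [h3, ← mul_assoc, ← Complex.ofReal_mul, ← Real.rpow_add (by positivity)]
  simp only [neg_add_cancel, Real.rpow_zero, Complex.ofReal_one, one_mul, Complex.I_sq]
  congr 1
  ring

lemma lintegral_stdGaussian {g : EuclideanSpace ℝ ι → ℝ≥0∞} (hg : Measurable g) :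
    ∫⁻ x, g x ∂(stdGaussian (EuclideanSpace ℝ ι)) =
      ∫⁻ x, ENNReal.ofReal ((2 * Real.pi) ^ (-(Fintype.card ι / 2 : ℝ)) *
        Real.exp (-‖x‖ ^ 2 / 2)) * g x := by
  rw [stdGaussian_eq_withDensity, lintegral_withDensity_eq_lintegral_mul _ (by fun_prop) hg]
  rfl

variable [DecidableEq ι]

lemma lintegral_toEuclideanCLM {A : Matrix ι ι ℝ} (hA : A.det ≠ 0)
    {g : EuclideanSpace ℝ ι → ℝ≥0∞} (hg : Measurable g) :
    ∫⁻ x, g (Matrix.toEuclideanCLM (𝕜 := ℝ) A x) = ENNReal.ofReal |A.det⁻¹| * ∫⁻ x, g x := by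
  have hdet : LinearMap.det (Matrix.toEuclideanCLM (𝕜 := ℝ) A :
      EuclideanSpace ℝ ι →ₗ[ℝ] EuclideanSpace ℝ ι) = A.det := by
    rw [Matrix.coe_toEuclideanCLM_eq_toEuclideanLin, LinearMap.det_toLpLin]
  have h := Measure.map_linearMap_addHaar_eq_smul_addHaar
    (volume : Measure (EuclideanSpace ℝ ι)) (f := (Matrix.toEuclideanCLM (𝕜 := ℝ) A :
      EuclideanSpace ℝ ι →ₗ[ℝ] EuclideanSpace ℝ ι)) (by rwa [hdet])
  rw [hdet] at h
  have := congrArg (fun μ => ∫⁻ x, g x ∂μ) h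
  simp only [lintegral_smul_measure, smul_eq_mul] at this
  rw [← this, lintegral_map hg]
  · rfl
  · exact (Matrix.toEuclideanCLM (𝕜 := ℝ) A).continuous.measurable

lemma dotProduct_sqrt_mulVec (W B : Matrix ι ι ℝ)
    (x : EuclideanSpace ℝ ι) :
    dotProduct (Matrix.toEuclideanCLM (𝕜 := ℝ) (CFC.sqrt W) x).ofLp
      (B.mulVec (Matrix.toEuclideanCLM (𝕜 := ℝ) (CFC.sqrt W) x).ofLp) =
    dotProduct x.ofLp ((CFC.sqrt W * B * CFC.sqrt W).mulVec x.ofLp) := by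
  have hs : (CFC.sqrt W).IsHermitian := (CFC.sqrt_nonneg W).isSelfAdjoint
  have ht : (CFC.sqrt W).transpose = CFC.sqrt W := by simpa using hs.eq
  rw [Matrix.ofLp_toEuclideanCLM, ← Matrix.mulVec_mulVec, ← Matrix.mulVec_mulVec,
    Matrix.dotProduct_mulVec x.ofLp, ← Matrix.mulVec_transpose, ht]

lemma sqrt_mul_sqrt {W : Matrix ι ι ℝ} (hW : W.PosSemidef) : CFC.sqrt W * CFC.sqrt W = W :=
  CFC.sqrt_mul_sqrt_self _ hW.nonneg

lemma abs_det_sqrt {W : Matrix ι ι ℝ} (hW : W.PosSemidef) : |(CFC.sqrt W).det| = √W.det := by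
  conv_rhs => rw [← sqrt_mul_sqrt hW, Matrix.det_mul]
  rw [← sq, Real.sqrt_sq_eq_abs]

lemma sqrt_mul_inv_mul_sqrt {W : Matrix ι ι ℝ} (hW : W.PosDef) :
    CFC.sqrt W * W⁻¹ * CFC.sqrt W = 1 := by
  have h := sqrt_mul_sqrt hW.posSemidef
  have hu : IsUnit (CFC.sqrt W).det := by
    have : (CFC.sqrt W).det * (CFC.sqrt W).det = W.det := by rw [← Matrix.det_mul, h]
    refine isUnit_iff_ne_zero.2 fun h0 => ?_
    rw [h0, zero_mul] at this
    exact hW.det_pos.ne this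
  have hinv : W⁻¹ = (CFC.sqrt W)⁻¹ * (CFC.sqrt W)⁻¹ := by rw [← Matrix.mul_inv_rev, h]
  rw [hinv, ← mul_assoc, Matrix.mul_nonsing_inv _ hu, one_mul, Matrix.nonsing_inv_mul _ hu]

/-- The Gaussian expectation of the exponential of a quadratic form. -/
lemma lintegral_exp_quadratic_stdGaussian {B : Matrix ι ι ℝ} (hB : (1 + B).PosDef) :
    ∫⁻ x, ENNReal.ofReal (Real.exp (-(dotProduct x.ofLp (B.mulVec x.ofLp)) / 2))
      ∂(stdGaussian (EuclideanSpace ℝ ι)) = ENNReal.ofReal (√(1 + B).det)⁻¹ := by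
  have hm : ∀ C : Matrix ι ι ℝ, Measurable fun x : EuclideanSpace ℝ ι =>
      ENNReal.ofReal (Real.exp (-(dotProduct x.ofLp (C.mulVec x.ofLp)) / 2)) := fun C => by
    simp only [dotProduct, Matrix.mulVec]
    fun_prop
  have hd : (CFC.sqrt (1 + B)).det ≠ 0 := by
    have h1 := abs_det_sqrt hB.posSemidef
    intro h0
    rw [h0, abs_zero] at h1
    exact (Real.sqrt_pos.2 hB.det_pos).ne h1
  have hnorm : ∀ x : EuclideanSpace ℝ ι, ‖x‖ ^ 2 = dotProduct x.ofLp x.ofLp := fun x => by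
    rw [EuclideanSpace.real_norm_sq_eq, dotProduct]
    exact Finset.sum_congr rfl fun i _ => sq _
  have hone := lintegral_stdGaussian (ι := ι) (g := fun _ => 1) measurable_const
  simp only [lintegral_const, measure_univ, mul_one] at hone
  -- Substituting `√(1 + B) x` in the standard density produces the integrand, and the Jacobian is
  -- the claimed constant.
  have hcv := lintegral_toEuclideanCLM hd (g := fun x => ENNReal.ofReal
    ((2 * Real.pi) ^ (-(Fintype.card ι / 2 : ℝ)) * Real.exp (-‖x‖ ^ 2 / 2))) (by fun_prop)
  rw [← hone, mul_one, abs_inv, abs_det_sqrt hB.posSemidef] at hcv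
  rw [← hcv, lintegral_stdGaussian (hm B)]
  refine lintegral_congr fun x => ?_
  rw [← ENNReal.ofReal_mul (by positivity), mul_assoc, ← Real.exp_add, hnorm, hnorm]
  have := dotProduct_sqrt_mulVec (1 + B) 1 x
  simp only [Matrix.one_mulVec, mul_one, sqrt_mul_sqrt hB.posSemidef] at this
  rw [this, Matrix.add_mulVec, Matrix.one_mulVec, dotProduct_add]
  congr 3
  ring

end GaussianIntegrals

/-! ### The covariance matrix and its determinant. -/

section CorrelationMatrix

variable {n : ℕ}

lemma corrMatrix_empty (ρ : ℝ) : corrMatrix ρ (∅ : Finset (Fin n)) = 1 := by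
  ext i j
  simp [corrMatrix, Matrix.one_apply]

lemma corrMatrix_eq (ρ : ℝ) (S : Finset (Fin n)) :
    corrMatrix ρ S = Matrix.diagonal (fun i => if i ∈ S then 1 - ρ else 1) +
      ρ • Matrix.vecMulVec (fun i => if i ∈ S then (1 : ℝ) else 0)
        (star fun i => if i ∈ S then (1 : ℝ) else 0) := by
  ext i j
  by_cases hij : i = j
  · subst hij
    by_cases hi : i ∈ S <;> simp [corrMatrix, Matrix.vecMulVec_apply, hi]
  · by_cases hi : i ∈ S <;> by_cases hj : j ∈ S <;>
      simp [corrMatrix, Matrix.vecMulVec_apply, hi, hj, hij]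

lemma posSemidef_corrMatrix {ρ : ℝ} (h0 : 0 ≤ ρ) (h1 : ρ ≤ 1) (S : Finset (Fin n)) :
    (corrMatrix ρ S).PosSemidef := by
  rw [corrMatrix_eq]
  refine (Matrix.PosSemidef.diagonal fun i => ?_).add
    ((Matrix.posSemidef_vecMulVec_self_star _).smul h0)
  simp only [Pi.zero_apply]
  split_ifs <;> linarith

lemma posDef_corrMatrix {ρ : ℝ} (h0 : 0 ≤ ρ) (h1 : ρ < 1) (S : Finset (Fin n)) :
    (corrMatrix ρ S).PosDef := by
  rw [corrMatrix_eq]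
  refine (Matrix.PosDef.diagonal fun i => ?_).add_posSemidef
    ((Matrix.posSemidef_vecMulVec_self_star _).smul h0)
  split_ifs <;> linarith

/-- The matrix is `1 - ρ` times a rank-one perturbation of the identity, so the matrix determinant
lemma applies. -/
lemma det_corrMatrix_univ {ρ : ℝ} (h1 : ρ < 1) (m : ℕ) :
    (corrMatrix ρ (Finset.univ : Finset (Fin (m + 1)))).det = (1 - ρ) ^ m * (1 + m * ρ) := by
  have h : (1 - ρ) ≠ 0 := by linarith
  have hV : corrMatrix ρ (Finset.univ : Finset (Fin (m + 1))) = (1 - ρ) •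
      (1 + Matrix.replicateCol Unit (fun _ => ρ / (1 - ρ)) *
        Matrix.replicateRow Unit fun _ => (1 : ℝ)) := by
    ext i j
    by_cases hij : i = j
    · subst hij
      simp [corrMatrix, Matrix.mul_apply]
      field_simp
      ring
    · simp [corrMatrix, Matrix.mul_apply, hij]
      field_simp
  rw [hV, Matrix.det_smul, Matrix.det_one_add_replicateCol_mul_replicateRow]
  simp [dotProduct]
  field_simp
  ring

lemma half_one_add_corrMatrix (ρ : ℝ) (S : Finset (Fin n)) :
    (2⁻¹ : ℝ) • (1 + corrMatrix ρ S) = corrMatrix (ρ / 2) S := by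
  ext i j
  by_cases hij : i = j
  · subst hij
    simp [corrMatrix]
    norm_num
  · simp [corrMatrix, hij]
    split_ifs <;> ring

end CorrelationMatrix

/-! ### Upper bound for the Hellinger affinity. -/

section Affinity

/-- The squared Hellinger affinity between the laws of `d` uncorrelated and of `d` correlated
coordinates. -/
noncomputable def sqAffinity (d : ℕ) (ρ : ℝ) : ℝ :=
  √(corrMatrix ρ (Finset.univ : Finset (Fin d))).det /
    (corrMatrix (ρ / 2) (Finset.univ : Finset (Fin d))).det

lemma sqAffinity_pos {ρ : ℝ} (h0 : 0 ≤ ρ) (h1 : ρ < 1) (d : ℕ) : 0 < sqAffinity d ρ :=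
  div_pos (Real.sqrt_pos.2 (posDef_corrMatrix h0 h1 _).det_pos)
    (posDef_corrMatrix (by linarith) (by linarith) _).det_pos

/-- Since 1 - ρ ≤ (1 - ρ/2)², the powers in the two determinants can be dropped. With x = mρ, what
remains is (1 + x) / (1 + x/2)² ≤ exp(-x²/16). -/
lemma sqAffinity_le {ρ : ℝ} (h0 : 0 ≤ ρ) (h1 : ρ < 1) (m : ℕ) (hx : m * ρ ≤ 2) :
    sqAffinity (m + 1) ρ ≤ Real.exp (-(m * ρ) ^ 2 / 32) := by
  have hx0 : 0 ≤ m * ρ := by positivity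
  have hs : (1 - ρ) ^ m ≤ ((1 - ρ / 2) ^ m) ^ 2 := by
    rw [← pow_mul, mul_comm m 2, pow_mul]
    exact pow_le_pow_left₀ (by linarith) (by nlinarith) _
  have hp : 0 < (1 - ρ / 2) ^ m := pow_pos (by linarith) _
  rw [sqAffinity, det_corrMatrix_univ h1, det_corrMatrix_univ (by linarith),
    div_le_iff₀ (by positivity)]
  refine Real.sqrt_le_iff.2 ⟨by positivity, ?_⟩
  have he : Real.exp (-(m * ρ) ^ 2 / 32) ^ 2 = Real.exp (-((m * ρ) ^ 2 / 16)) := by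
    rw [← Real.exp_nat_mul]
    congr 1
    push_cast
    ring
  rw [mul_pow (Real.exp _), mul_pow ((1 - ρ / 2) ^ m), he]
  have hexp := Real.one_sub_le_exp_neg ((m * ρ) ^ 2 / 16)
  have hkey : 1 + m * ρ ≤ (1 + m * (ρ / 2)) ^ 2 * Real.exp (-((m * ρ) ^ 2 / 16)) := by
    have h2 : m * (ρ / 2) = m * ρ / 2 := by ring
    rw [h2]
    generalize m * ρ = x at *
    refine le_trans ?_ (mul_le_mul_of_nonneg_left hexp (by positivity))
    -- (1 + x/2)² exceeds 1 + x by x²/4, which dominates the loss (1 + x/2)² x²/16 as long as 1 +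
    -- x/2 ≤ 2; this is where x ≤ 2 enters.
    have : 0 ≤ x ^ 2 * ((2 - (1 + x / 2)) * (2 + (1 + x / 2))) :=
      mul_nonneg (sq_nonneg _) (mul_nonneg (by linarith) (by linarith))
    nlinarith
  calc (1 - ρ) ^ m * (1 + m * ρ)
      ≤ ((1 - ρ / 2) ^ m) ^ 2 *
          ((1 + m * (ρ / 2)) ^ 2 * Real.exp (-((m * ρ) ^ 2 / 16))) :=
        mul_le_mul hs hkey (by positivity) (by positivity)
    _ = _ := by ring

end Affinity

/-! ### Expected square root of the likelihood ratio under either hypothesis. -/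

section LikelihoodRatio

open scoped MatrixOrder

variable {d : ℕ}

lemma gaussianDensity_pos {V : Matrix (Fin d) (Fin d) ℝ} (hV : V.PosDef)
    (x : EuclideanSpace ℝ (Fin d)) : 0 < gaussianDensity V x := by
  have := hV.det_pos
  rw [gaussianDensity]
  positivity

@[fun_prop]
lemma measurable_gaussianDensity (V : Matrix (Fin d) (Fin d) ℝ) :
    Measurable (gaussianDensity V) := by
  unfold gaussianDensity
  simp only [dotProduct, Matrix.mulVec]
  fun_prop

lemma measurable_likelihoodRatio {q : ℕ} {f₀ f₁ : EuclideanSpace ℝ (Fin d) → ℝ}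
    (h₀ : Measurable f₀) (h₁ : Measurable f₁) :
    Measurable (likelihoodRatio (q := q) f₀ f₁) := by
  unfold likelihoodRatio
  fun_prop

lemma gaussianDensity_div (V W : Matrix (Fin d) (Fin d) ℝ) (x : EuclideanSpace ℝ (Fin d)) :
    gaussianDensity W x / gaussianDensity V x = √V.det / √W.det *
      Real.exp (-(dotProduct x.ofLp ((W⁻¹ - V⁻¹).mulVec x.ofLp)) / 2) := by
  have h2 : (0 : ℝ) ≤ (2 * Real.pi) ^ d := by positivity
  have h3 : √((2 * Real.pi) ^ d) ≠ 0 := by positivity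
  rw [gaussianDensity, gaussianDensity, Real.sqrt_mul h2, Real.sqrt_mul h2, mul_inv, mul_inv,
    mul_div_mul_comm, mul_div_mul_left _ _ (inv_ne_zero h3), ← Real.exp_sub, inv_div_inv,
    Matrix.sub_mulVec, dotProduct_sub]
  congr 2
  ring

lemma sampleLaw_empty {n : ℕ} (ρ : ℝ) : sampleLaw ρ (∅ : Finset (Fin n)) = stdGaussian _ := by
  rw [sampleLaw, corrMatrix_empty, multivariateGaussian_zero_one]

instance {n : ℕ} (ρ : ℝ) (S : Finset (Fin n)) : IsProbabilityMeasure (sampleLaw ρ S) := by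
  unfold sampleLaw
  infer_instance

lemma sqrt_exp_neg_div_two (y : ℝ) : √(Real.exp (-y / 2)) = Real.exp (-(2⁻¹ * y) / 2) := by
  rw [Real.sqrt_eq_iff_mul_self_eq (by positivity) (by positivity), ← Real.exp_add]
  congr 1
  ring

/-- This is the affinity ∫ √(f₀ f₁): the square root halves the quadratic form V⁻¹ - 1, and the
determinant of (1 + V⁻¹)/2 is that of (1 + V)/2 divided by det V. -/
lemma lintegral_sqrt_ratio_null {V : Matrix (Fin d) (Fin d) ℝ} (hV : V.PosDef) :
    ∫⁻ x, ENNReal.ofReal √(gaussianDensity V x / gaussianDensity 1 x)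
      ∂(stdGaussian (EuclideanSpace ℝ (Fin d))) =
      ENNReal.ofReal √(√V.det / ((2⁻¹ : ℝ) • (1 + V)).det) := by
  have hB : (1 + (2⁻¹ : ℝ) • (V⁻¹ - 1)) = (2⁻¹ : ℝ) • (1 + V⁻¹) := by
    ext i j
    simp
    ring
  have hP : (1 + (2⁻¹ : ℝ) • (V⁻¹ - 1)).PosDef := by
    rw [hB]
    exact (Matrix.PosDef.one.add hV.inv).smul (by norm_num)
  have hdet : (1 + (2⁻¹ : ℝ) • (V⁻¹ - 1)).det = ((2⁻¹ : ℝ) • (1 + V)).det / V.det := by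
    have hu : IsUnit V.det := hV.det_pos.ne'.isUnit
    rw [hB, eq_div_iff hV.det_pos.ne', ← Matrix.det_mul, Matrix.smul_mul, add_mul,
      Matrix.nonsing_inv_mul _ hu, one_mul, add_comm]
  have hrw : ∀ x : EuclideanSpace ℝ (Fin d),
      ENNReal.ofReal √(gaussianDensity V x / gaussianDensity 1 x) =
      ENNReal.ofReal √(1 / √V.det) * ENNReal.ofReal (Real.exp
        (-(dotProduct x.ofLp (((2⁻¹ : ℝ) • (V⁻¹ - 1)).mulVec x.ofLp)) / 2)) := fun x => by
    rw [← ENNReal.ofReal_mul (by positivity), gaussianDensity_div,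
      Real.sqrt_mul (by positivity), sqrt_exp_neg_div_two, Matrix.smul_mulVec, dotProduct_smul]
    simp
  simp_rw [hrw]
  rw [lintegral_const_mul' _ _ ENNReal.ofReal_ne_top, lintegral_exp_quadratic_stdGaussian hP,
    ← ENNReal.ofReal_mul (by positivity), hdet, ← Real.sqrt_inv,
    ← Real.sqrt_mul (by positivity)]
  congr 2
  have := Real.mul_self_sqrt hV.det_pos.le
  have h0 := (Real.sqrt_pos.2 hV.det_pos).ne'
  field_simp
  rw [sq, this]

/-- The same affinity, seen from the alternative: writing the sample as √V applied to a standard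
Gaussian turns the quadratic form 1 - V⁻¹ into V - 1. -/
lemma lintegral_sqrt_ratio_alt {V : Matrix (Fin d) (Fin d) ℝ} (hV : V.PosDef) :
    ∫⁻ x, ENNReal.ofReal √(gaussianDensity 1 x / gaussianDensity V x)
      ∂(multivariateGaussian 0 V) =
      ENNReal.ofReal √(√V.det / ((2⁻¹ : ℝ) • (1 + V)).det) := by
  have hB : (1 + (2⁻¹ : ℝ) • (V - 1)) = (2⁻¹ : ℝ) • (1 + V) := by
    ext i j
    simp
    ring
  have hP : (1 + (2⁻¹ : ℝ) • (V - 1)).PosDef := by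
    rw [hB]
    exact (Matrix.PosDef.one.add hV).smul (by norm_num)
  have hC : CFC.sqrt V * (1⁻¹ - V⁻¹) * CFC.sqrt V = V - 1 := by
    rw [mul_sub, sub_mul, sqrt_mul_inv_mul_sqrt hV, inv_one, mul_one, sqrt_mul_sqrt hV.posSemidef]
  have hrw : ∀ x : EuclideanSpace ℝ (Fin d),
      ENNReal.ofReal √(gaussianDensity 1 (Matrix.toEuclideanCLM (𝕜 := ℝ) (CFC.sqrt V) x) /
        gaussianDensity V (Matrix.toEuclideanCLM (𝕜 := ℝ) (CFC.sqrt V) x)) =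
      ENNReal.ofReal √√V.det * ENNReal.ofReal (Real.exp
        (-(dotProduct x.ofLp (((2⁻¹ : ℝ) • (V - 1)).mulVec x.ofLp)) / 2)) := fun x => by
    rw [← ENNReal.ofReal_mul (by positivity), gaussianDensity_div,
      Real.sqrt_mul (by positivity), sqrt_exp_neg_div_two, dotProduct_sqrt_mulVec, hC,
      Matrix.smul_mulVec, dotProduct_smul]
    simp
  rw [multivariateGaussian, lintegral_map (by fun_prop) (by fun_prop)]
  simp_rw [zero_add, hrw]
  rw [lintegral_const_mul' _ _ ENNReal.ofReal_ne_top, lintegral_exp_quadratic_stdGaussian hP,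
    ← ENNReal.ofReal_mul (by positivity), hB, Real.sqrt_div (by positivity), div_eq_mul_inv]

end LikelihoodRatio

/-! ### The lower median. -/

section Median

variable (μ : Measure ℝ) [IsProbabilityMeasure μ]

lemma half_le_measure_Iic_iff (x : ℝ) : 1 / 2 ≤ μ (Set.Iic x) ↔ 1 / 2 ≤ cdf μ x := by
  rw [← ofReal_cdf, ← ENNReal.ofReal_one, ← ENNReal.ofReal_ofNat 2,
    ← ENNReal.ofReal_div_of_pos (by norm_num), ENNReal.ofReal_le_ofReal_iff (cdf_nonneg μ x)]

lemma bddBelow_median_set : BddBelow {x | 1 / 2 ≤ μ (Set.Iic x)} := by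
  obtain ⟨y, hy⟩ := ((tendsto_cdf_atBot μ).eventually_lt_const
    (show (0 : ℝ) < 1 / 2 by norm_num)).exists
  refine ⟨y, fun x hx => ?_⟩
  by_contra! hlt
  have := (half_le_measure_Iic_iff μ x).1 hx
  linarith [monotone_cdf μ hlt.le]

lemma median_le {x : ℝ} (hx : 1 / 2 ≤ μ (Set.Iic x)) : median μ ≤ x :=
  csInf_le (bddBelow_median_set μ) hx

/-- Right continuity of the distribution function makes the infimum attained, with no assumption on
atoms. -/
lemma half_le_measure_Iic_median : 1 / 2 ≤ μ (Set.Iic (median μ)) := by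
  rw [half_le_measure_Iic_iff]
  have hne : {x | 1 / 2 ≤ μ (Set.Iic x)}.Nonempty := by
    obtain ⟨y, hy⟩ := ((tendsto_cdf_atTop μ).eventually_const_lt
      (show (1 / 2 : ℝ) < 1 by norm_num)).exists
    exact ⟨y, (half_le_measure_Iic_iff μ y).2 hy.le⟩
  have hc : Tendsto (cdf μ) (𝓝[>] median μ) (𝓝 (cdf μ (median μ))) :=
    ((cdf μ).right_continuous (median μ)).mono_left (nhdsWithin_mono _ Set.Ioi_subset_Ici_self)
  refine ge_of_tendsto hc (eventually_nhdsWithin_of_forall fun y hy => ?_)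
  obtain ⟨x, hx, hxy⟩ := exists_lt_of_csInf_lt hne hy
  exact ((half_le_measure_Iic_iff μ x).1 hx).trans (monotone_cdf μ hxy.le)

lemma measure_Ioi_median_le : μ (Set.Ioi (median μ)) ≤ 1 / 2 := by
  rw [← Set.compl_Iic, prob_compl_eq_one_sub measurableSet_Iic]
  refine (tsub_le_tsub_left (half_le_measure_Iic_median μ) 1).trans ?_
  simp

end Median

/-! ### Error of the likelihood ratio test at the null median. -/

section LikelihoodRatioTest

variable {d q : ℕ}

lemma lintegral_pi_prod {E : Type*} [MeasurableSpace E] (μ : Measure E) [IsProbabilityMeasure μ]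
    {g : E → ℝ≥0∞} (hg : Measurable g) :
    ∫⁻ z : Fin q → E, ∏ t, g (z t) ∂(Measure.pi fun _ => μ) = (∫⁻ x, g x ∂μ) ^ q := by
  have hi : iIndepFun (fun t (z : Fin q → E) => g (z t)) (Measure.pi fun _ => μ) :=
    iIndepFun_pi (X := fun _ => g) fun _ => hg.aemeasurable
  refine (lintegral_prod_eq_prod_lintegral_of_indepFun Finset.univ _ hi
    fun t => by fun_prop).trans ?_
  simp_rw [fun t => (measurePreserving_eval (fun _ : Fin q => μ) t).lintegral_comp hg]
  simp

lemma ofReal_sqrt_likelihoodRatio {f₀ f₁ : EuclideanSpace ℝ (Fin d) → ℝ} (h₀ : ∀ x, 0 < f₀ x)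
    (h₁ : ∀ x, 0 < f₁ x) (z : Fin q → EuclideanSpace ℝ (Fin d)) :
    ENNReal.ofReal √(likelihoodRatio f₀ f₁ z) =
      ∏ t, ENNReal.ofReal √(f₁ (z t) / f₀ (z t)) := by
  rw [likelihoodRatio, ← Finset.prod_div_distrib,
    Real.sqrt_prod _ fun t _ => (div_pos (h₁ _) (h₀ _)).le,
    ENNReal.ofReal_prod_of_nonneg fun _ _ => Real.sqrt_nonneg _]

/-- Markov's inequality for the square root of the likelihood ratio. -/
lemma measure_le_likelihoodRatio_le (μ : Measure (EuclideanSpace ℝ (Fin d)))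
    [IsProbabilityMeasure μ] {f₀ f₁ : EuclideanSpace ℝ (Fin d) → ℝ} (m₀ : Measurable f₀)
    (m₁ : Measurable f₁) (h₀ : ∀ x, 0 < f₀ x) (h₁ : ∀ x, 0 < f₁ x) {b : ℝ} (hb : 0 < b)
    (h : ∫⁻ x, ENNReal.ofReal √(f₁ x / f₀ x) ∂μ = ENNReal.ofReal √b) {x : ℝ} (hx : 0 < x) :
    (Measure.pi fun _ : Fin q => μ) {z | x ≤ likelihoodRatio f₀ f₁ z} ≤
      ENNReal.ofReal √(b ^ q / x) := by
  have hpi : ∫⁻ z, ENNReal.ofReal √(likelihoodRatio f₀ f₁ z) ∂(Measure.pi fun _ : Fin q => μ) =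
      ENNReal.ofReal √(b ^ q) := by
    simp_rw [ofReal_sqrt_likelihoodRatio h₀ h₁]
    rw [lintegral_pi_prod μ (g := fun x => ENNReal.ofReal √(f₁ x / f₀ x)) (by fun_prop), h, ← ENNReal.ofReal_pow (Real.sqrt_nonneg _),
      Real.sqrt_eq_rpow, Real.sqrt_eq_rpow, ← Real.rpow_natCast, ← Real.rpow_natCast,
      ← Real.rpow_mul hb.le, ← Real.rpow_mul hb.le, mul_comm]
  have hm := mul_meas_ge_le_lintegral (μ := Measure.pi fun _ : Fin q => μ)
    (f := fun z => ENNReal.ofReal √(likelihoodRatio f₀ f₁ z))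
    ((measurable_likelihoodRatio m₀ m₁).sqrt.ennreal_ofReal) (ENNReal.ofReal √x)
  rw [hpi, mul_comm] at hm
  rw [Real.sqrt_div (by positivity), ENNReal.ofReal_div_of_pos (Real.sqrt_pos.2 hx)]
  refine (ENNReal.le_div_iff_mul_le (Or.inl (by simpa using hx)) (Or.inl (by simp))).2
    (le_trans (mul_le_mul_left ?_ _) hm)
  exact measure_mono fun z hz => ENNReal.ofReal_le_ofReal (Real.sqrt_le_sqrt hz)

/-- Markov's inequality is used twice. Under μ₀ the ratio reaches 4 b^q with probability at most
1/2, so the median is at most 4 b^q. Under μ₁ the inverse ratio reaches 1/(4 b^q) with probability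
at most √(b^q · 4 b^q) = 2 b^q. -/
lemma measure_likelihoodRatio_le_median_le (μ₀ μ₁ : Measure (EuclideanSpace ℝ (Fin d)))
    [IsProbabilityMeasure μ₀] [IsProbabilityMeasure μ₁]
    {f₀ f₁ : EuclideanSpace ℝ (Fin d) → ℝ} (m₀ : Measurable f₀)
    (m₁ : Measurable f₁) (p₀ : ∀ x, 0 < f₀ x) (p₁ : ∀ x, 0 < f₁ x) {b : ℝ} (hb : 0 < b)
    (h₀ : ∫⁻ x, ENNReal.ofReal √(f₁ x / f₀ x) ∂μ₀ = ENNReal.ofReal √b)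
    (h₁ : ∫⁻ x, ENNReal.ofReal √(f₀ x / f₁ x) ∂μ₁ = ENNReal.ofReal √b) :
    (Measure.pi fun _ : Fin q => μ₁) {z | likelihoodRatio f₀ f₁ z ≤
      median ((Measure.pi fun _ : Fin q => μ₀).map (likelihoodRatio f₀ f₁))} ≤
      ENNReal.ofReal (2 * b ^ q) := by
  have hL := measurable_likelihoodRatio (q := q) m₀ m₁
  have := Measure.isProbabilityMeasure_map (μ := Measure.pi fun _ : Fin q => μ₀) hL.aemeasurable
  have hbq : 0 < b ^ q := pow_pos hb q
  have hmed : median ((Measure.pi fun _ : Fin q => μ₀).map (likelihoodRatio f₀ f₁)) ≤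
      4 * b ^ q := by
    refine median_le _ ?_
    rw [Measure.map_apply hL measurableSet_Iic, ← compl_compl (_ ⁻¹' _),
      prob_compl_eq_one_sub (hL measurableSet_Iic).compl]
    have h := measure_le_likelihoodRatio_le (q := q) μ₀ m₀ m₁ p₀ p₁ hb h₀
      (show 0 < 4 * b ^ q by positivity)
    have h4 : √(b ^ q / (4 * b ^ q)) = 1 / 2 := by
      rw [Real.sqrt_eq_iff_mul_self_eq (by positivity) (by norm_num)]
      field_simp
      norm_num
    rw [h4, ENNReal.ofReal_div_of_pos (by norm_num), ENNReal.ofReal_one,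
      ENNReal.ofReal_ofNat] at h
    have h5 : (1 : ℝ≥0∞) / 2 = 1 - 1 / 2 := by simp
    rw [h5]
    refine tsub_le_tsub_left (le_trans (measure_mono fun z hz => ?_) h) 1
    simp only [Set.mem_compl_iff, Set.mem_preimage, Set.mem_Iic, not_le] at hz
    exact hz.le
  have h := measure_le_likelihoodRatio_le (q := q) μ₁ m₁ m₀ p₁ p₀ hb h₁
    (show 0 < (4 * b ^ q)⁻¹ by positivity)
  have h4 : √(b ^ q / (4 * b ^ q)⁻¹) = 2 * b ^ q := by
    rw [Real.sqrt_eq_iff_mul_self_eq (by positivity) (by positivity)]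
    field_simp
    norm_num
  rw [h4] at h
  refine le_trans (measure_mono fun z hz => ?_) h
  have hpos : 0 < likelihoodRatio f₀ f₁ z :=
    div_pos (Finset.prod_pos fun _ _ => p₁ _) (Finset.prod_pos fun _ _ => p₀ _)
  have hinv : likelihoodRatio f₁ f₀ z = (likelihoodRatio f₀ f₁ z)⁻¹ := by
    simp [likelihoodRatio]
  simp only [Set.mem_ofPred_eq, hinv] at hz ⊢
  exact inv_anti₀ hpos (hz.trans hmed)

end LikelihoodRatioTest

/-! ### The test applied to one batch of one row. -/

section RowTest

/-- The likelihood ratio statistic of `q` observations of `d` coordinates. -/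
noncomputable abbrev rowStat (d q : ℕ) (ρ : ℝ) : (Fin q → EuclideanSpace ℝ (Fin d)) → ℝ :=
  likelihoodRatio (gaussianDensity (corrMatrix ρ (∅ : Finset (Fin d))))
    (gaussianDensity (corrMatrix ρ (Finset.univ : Finset (Fin d))))

lemma measurable_rowStat (d q : ℕ) (ρ : ℝ) : Measurable (rowStat d q ρ) :=
  measurable_likelihoodRatio (by fun_prop) (by fun_prop)

lemma null_exceed_threshold_le (d q : ℕ) (ρ : ℝ) :
    (Measure.pi fun _ : Fin q => sampleLaw ρ (∅ : Finset (Fin d)))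
      {z | threshold d q ρ < rowStat d q ρ z} ≤ 1 / 2 := by
  have hL := measurable_rowStat d q ρ
  have := Measure.isProbabilityMeasure_map
    (μ := Measure.pi fun _ : Fin q => sampleLaw ρ (∅ : Finset (Fin d))) hL.aemeasurable
  have h := measure_Ioi_median_le
    ((Measure.pi fun _ : Fin q => sampleLaw ρ (∅ : Finset (Fin d))).map (rowStat d q ρ))
  rwa [Measure.map_apply hL measurableSet_Ioi] at h

lemma alt_le_threshold_le (d q : ℕ) {ρ : ℝ} (h0 : 0 ≤ ρ) (h1 : ρ < 1) :
    (Measure.pi fun _ : Fin q => sampleLaw ρ (Finset.univ : Finset (Fin d)))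
      {z | rowStat d q ρ z ≤ threshold d q ρ} ≤ ENNReal.ofReal (2 * sqAffinity d ρ ^ q) := by
  have hV := posDef_corrMatrix h0 h1 (Finset.univ : Finset (Fin d))
  refine measure_likelihoodRatio_le_median_le _ _ (by fun_prop) (by fun_prop)
    (gaussianDensity_pos (posDef_corrMatrix h0 h1 _)) (gaussianDensity_pos hV)
    (sqAffinity_pos h0 h1 d) ?_ ?_
  · rw [sampleLaw_empty, corrMatrix_empty, lintegral_sqrt_ratio_null hV, half_one_add_corrMatrix,
      sqAffinity]
  · rw [corrMatrix_empty, sampleLaw, lintegral_sqrt_ratio_alt hV, half_one_add_corrMatrix,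
      sqAffinity]

end RowTest

/-! ### Grouping independent variables into independent families. -/

section Curry

variable {Ω ι κ 𝓧 : Type*} [MeasurableSpace Ω] {P : Measure Ω}

/-- Independence says that the joint law is a product measure, and currying a product over pairs
gives a product of products. -/
lemma iIndepFun_curry [MeasurableSpace 𝓧] {X : ι → κ → Ω → 𝓧}
    (mX : ∀ i j, Measurable (X i j)) (h : iIndepFun (fun (p : ι × κ) => X p.1 p.2) P) :
    iIndepFun (fun i ω j => X i j ω) P := by
  have := h.isProbabilityMeasure
  have hp : ∀ i j, IsProbabilityMeasure (P.map (X i j)) := fun i j =>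
    Measure.isProbabilityMeasure_map (mX i j).aemeasurable
  have h1 := h.map_fun_eq_infinitePi_map fun p : ι × κ => mX p.1 p.2
  have h2 : ∀ i, P.map (fun ω j => X i j ω) = Measure.infinitePi fun j => P.map (X i j) :=
    fun i => (h.precomp (g := fun j => (i, j))
      fun a b hab => (Prod.ext_iff.1 hab).2).map_fun_eq_infinitePi_map (mX i)
  rw [iIndepFun_iff_map_fun_eq_infinitePi_map fun i => measurable_pi_lambda _ (mX i)]
  simp_rw [h2]
  rw [← Measure.infinitePi_map_curry (fun i j => P.map (X i j)), ← h1,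
    Measure.map_map (by fun_prop) (measurable_pi_lambda _ fun p : ι × κ => mX p.1 p.2)]
  rfl

end Curry

/-! ### Laws and independence of the rows of one sample. -/

section RowLaw

variable {n k d j : ℕ}

lemma mem_block {i : Fin n} : i ∈ block n k d j ↔ j * k ≤ (i : ℕ) ∧ (i : ℕ) < j * k + d := by
  simp [block]

lemma index_lt (hdk : d ≤ k) (i : Fin (n / k)) (l : Fin d) : (i : ℕ) * k + l < n := by
  have h1 : (i : ℕ) + 1 ≤ n / k := i.2
  have h2 := Nat.mul_le_mul_right k h1
  have h3 := Nat.div_mul_le_self n k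
  have h4 := l.2
  rw [add_mul] at h2
  lia

/-- The position of the `l`-th kept coordinate of the `i`-th block. -/
def index (hdk : d ≤ k) (i : Fin (n / k)) (l : Fin d) : Fin n := ⟨i * k + l, index_lt hdk i l⟩

lemma row_eq (hdk : d ≤ k) (x : EuclideanSpace ℝ (Fin n)) (i : Fin (n / k)) :
    row k d x i = WithLp.toLp 2 fun l => x (index hdk i l) := by
  ext l
  simp [row, index, index_lt hdk i l]

lemma measurable_row (k d j : ℕ) : Measurable fun x : EuclideanSpace ℝ (Fin n) => row k d x j := by
  unfold row
  refine (WithLp.measurable_toLp 2 _).comp (measurable_pi_lambda _ fun i => ?_)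
  split_ifs <;> fun_prop

lemma index_eq_iff (hdk : d ≤ k) {i i' : Fin (n / k)} {l l' : Fin d} :
    index hdk i l = index hdk i' l' ↔ i = i' ∧ l = l' := by
  refine ⟨fun h => ?_, fun h => by rw [h.1, h.2]⟩
  have h := congrArg Fin.val h
  simp only [index] at h
  have hl : (l : ℕ) < k := l.2.trans_le hdk
  have hl' : (l' : ℕ) < k := l'.2.trans_le hdk
  have h1 : ((i : ℕ) * k + l) / k = i := by
    rw [mul_comm, Nat.mul_add_div (by lia), Nat.div_eq_of_lt hl, add_zero]
  have h2 : ((i' : ℕ) * k + l') / k = i' := by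
    rw [mul_comm, Nat.mul_add_div (by lia), Nat.div_eq_of_lt hl', add_zero]
  have hi : (i : ℕ) = i' := by rw [← h1, h, h2]
  rw [hi] at h
  exact ⟨Fin.ext hi, Fin.ext (by lia)⟩

lemma index_mem_block (hdk : d ≤ k) (i i' : Fin (n / k)) (l : Fin d) :
    index hdk i l ∈ block n k k i' ↔ i = i' := by
  have hl : (l : ℕ) < k := l.2.trans_le hdk
  rw [mem_block, index, Fin.ext_iff]
  constructor
  · rintro ⟨h1, h2⟩
    have h3 : (i' : ℕ) < i + 1 := by
      by_contra! h
      have := Nat.mul_le_mul_right k h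
      rw [add_mul] at this
      lia
    have h4 : (i : ℕ) < i' + 1 := by
      by_contra! h
      have := Nat.mul_le_mul_right k h
      rw [add_mul] at this
      lia
    lia
  · intro h
    simp only [h]
    lia

/-- Reading off coordinates is linear, so the image is Gaussian and is identified by its mean and
covariance. -/
lemma map_comp_multivariateGaussian {ι κ : Type*} [Fintype ι] [Fintype κ] [DecidableEq ι]
    [DecidableEq κ] {S : Matrix ι ι ℝ} (hS : S.PosSemidef) (g : κ → ι) :
    (multivariateGaussian 0 S).map (fun x => WithLp.toLp 2 fun l => x (g l)) =
      multivariateGaussian 0 (S.submatrix g g) := by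
  let L : EuclideanSpace ℝ ι →L[ℝ] EuclideanSpace ℝ κ :=
    LinearMap.toContinuousLinearMap
      { toFun := fun x => WithLp.toLp 2 fun l => x (g l)
        map_add' := fun x y => by ext; simp
        map_smul' := fun c x => by ext; simp }
  have hL : (fun x : EuclideanSpace ℝ ι => WithLp.toLp 2 fun l => x (g l)) = L := rfl
  rw [hL]
  apply IsGaussian.ext
  · simp only [id_eq, integral_id_multivariateGaussian]
    rw [ContinuousLinearMap.integral_id_map, integral_id_multivariateGaussian, map_zero]
    exact IsGaussian.integrable_id
  rw [← ContinuousLinearMap.toBilinForm_inj]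
  refine LinearMap.BilinForm.ext_basis (EuclideanSpace.basisFun κ ℝ).toBasis fun i j => ?_
  rw [ContinuousLinearMap.toBilinForm_apply, ContinuousLinearMap.toBilinForm_apply,
    covarianceBilin_apply_eq_cov, covariance_map]
  · have (i : κ) : (fun u => inner ℝ ((EuclideanSpace.basisFun κ ℝ).toBasis i) u) ∘ L =
        fun u => u (g i) := by ext; simp [PiLp.inner_apply, L]
    simp_rw [this, covariance_eval_multivariateGaussian hS,
      covarianceBilin_multivariateGaussian (hS.submatrix _)]
    simp
  any_goals exact Measurable.aestronglyMeasurable (by fun_prop)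
  · fun_prop
  · exact IsGaussian.memLp_two_id

lemma map_row_sampleLaw {ρ : ℝ} (h0 : 0 ≤ ρ) (h1 : ρ ≤ 1) (S : Finset (Fin n)) (hdk : d ≤ k)
    (i : Fin (n / k)) (T : Finset (Fin d)) (hT : ∀ l, index hdk i l ∈ S ↔ l ∈ T) :
    (sampleLaw ρ S).map (fun x => row k d x i) = sampleLaw ρ T := by
  simp_rw [row_eq hdk]
  rw [sampleLaw, map_comp_multivariateGaussian (posSemidef_corrMatrix h0 h1 S), sampleLaw]
  congr 1
  ext l l'
  simp [corrMatrix, hT, index_eq_iff]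

/-- The rows are jointly Gaussian, and their cross-covariances vanish because the contaminated
coordinates among them lie in a single row. -/
lemma iIndepFun_row {ρ : ℝ} (h0 : 0 ≤ ρ) (h1 : ρ ≤ 1) (S : Finset (Fin n)) (hdk : d ≤ k)
    (hS : ∀ i i' : Fin (n / k), i ≠ i' → ∀ l l' : Fin d,
      ¬ (index hdk i l ∈ S ∧ index hdk i' l' ∈ S)) :
    iIndepFun (fun (i : Fin (n / k)) x => row k d x i) (sampleLaw ρ S) := by
  have hG : HasGaussianLaw (fun (x : EuclideanSpace ℝ (Fin n)) (i : Fin (n / k)) (l : Fin d) =>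
      x (index hdk i l)) (sampleLaw ρ S) := by
    have h : HasGaussianLaw (id : EuclideanSpace ℝ (Fin n) → _) (sampleLaw ρ S) :=
      ⟨by rw [Measure.map_id, sampleLaw]; infer_instance⟩
    exact h.map (LinearMap.toContinuousLinearMap
      { toFun := fun (x : EuclideanSpace ℝ (Fin n)) (i : Fin (n / k)) (l : Fin d) =>
          x (index hdk i l)
        map_add' := fun x y => rfl
        map_smul' := fun c x => rfl } :
          EuclideanSpace ℝ (Fin n) →L[ℝ] (Fin (n / k) → Fin d → ℝ))
  have h := hG.iIndepFun_of_covariance_eval fun i j hij l l' => by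
    rw [sampleLaw, covariance_eval_multivariateGaussian (posSemidef_corrMatrix h0 h1 S)]
    have : index hdk i l ≠ index hdk j l' := fun h => hij ((index_eq_iff hdk).1 h).1
    simp only [corrMatrix, Matrix.of_apply, if_neg this, if_neg (hS i j hij l l')]
  simp_rw [row_eq hdk]
  exact h.comp (fun _ => WithLp.toLp 2) fun _ => WithLp.measurable_toLp 2 _

end RowLaw

/-! ### Independence across batches and rows. -/

section Batches

variable {n k d M q K : ℕ}

lemma round_lt (hKq : K * q ≤ M) (s : Fin K) (t : Fin q) : (s : ℕ) * q + t < M := by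
  have h2 := Nat.mul_le_mul_right q (show (s : ℕ) + 1 ≤ K from s.2)
  have := t.2
  rw [add_mul] at h2
  lia

/-- The observations of the `i`-th row in the `s`-th batch. -/
def batchRow (k d : ℕ) (hKq : K * q ≤ M) (s : Fin K) (i : Fin (n / k))
    (u : Fin M → EuclideanSpace ℝ (Fin n)) (t : Fin q) : EuclideanSpace ℝ (Fin d) :=
  row k d (u ⟨s * q + t, round_lt hKq s t⟩) i

lemma measurable_batchRow (hKq : K * q ≤ M) (s : Fin K) (i : Fin (n / k)) :
    Measurable (batchRow (n := n) k d hKq s i) :=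
  measurable_pi_lambda _ fun _ => (measurable_row k d i).comp (measurable_pi_apply _)

/-- Independence over rounds and over rows within a round gives independence over all pairs (round,
row). Division by q then sorts the rounds injectively into batches, each of which is grouped into
one variable. -/
lemma iIndepFun_batchRow {μ : Measure (EuclideanSpace ℝ (Fin n))} [IsProbabilityMeasure μ]
    (hKq : K * q ≤ M) (h : iIndepFun (fun (i : Fin (n / k)) x => row k d x i) μ) :
    iIndepFun (fun p : Fin K × Fin (n / k) => batchRow k d hKq p.1 p.2)
      (Measure.pi fun _ : Fin M => μ) := by
  have hrow : Measurable fun (x : EuclideanSpace ℝ (Fin n)) (i : Fin (n / k)) => row k d x i :=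
    measurable_pi_lambda _ fun i => measurable_row k d i
  have hrow' : ∀ (t : Fin M) (i : Fin (n / k)),
      Measurable fun u : Fin M → EuclideanSpace ℝ (Fin n) => row k d (u t) i :=
    fun t i => (measurable_row k d i).comp (measurable_pi_apply t)
  have h1 : iIndepFun (fun (p : Fin M × Fin (n / k)) (u : Fin M → EuclideanSpace ℝ (Fin n)) =>
      row k d (u p.1) p.2) (Measure.pi fun _ : Fin M => μ) := by
    refine iIndepFun_uncurry' (X := fun (t : Fin M) (i : Fin (n / k))
      (u : Fin M → EuclideanSpace ℝ (Fin n)) => row k d (u t) i) hrow' ?_ fun t => ?_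
    · exact iIndepFun_pi (X := fun (_ : Fin M) x (i : Fin (n / k)) => row k d x i)
        fun _ => hrow.aemeasurable
    · rw [iIndepFun_iff_map_fun_eq_pi_map fun i => (hrow' t i).aemeasurable]
      have hm := measurePreserving_eval (fun _ : Fin M => μ) t
      have hrow₀ : ∀ i : Fin (n / k),
          AEMeasurable (fun x : EuclideanSpace ℝ (Fin n) => row k d x i) μ :=
        fun i => (measurable_row k d i).aemeasurable
      have h2 := h.map_fun_eq_pi_map hrow₀
      have h3 : ∀ i : Fin (n / k), (Measure.pi fun _ : Fin M => μ).map
          (fun u => row k d (u t) i) = μ.map fun x => row k d x i := fun i => by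
        conv_rhs => rw [← hm.map_eq, Measure.map_map (measurable_row k d i) hm.measurable]
        rfl
      simp_rw [h3]
      rw [← h2]
      conv_rhs => rw [← hm.map_eq, Measure.map_map hrow hm.measurable]
      rfl
  have hinj : Function.Injective fun p : (Fin K × Fin (n / k)) × Fin q =>
      ((⟨p.1.1 * q + p.2, round_lt hKq p.1.1 p.2⟩, p.1.2) : Fin M × Fin (n / k)) := by
    rintro ⟨⟨s, i⟩, t⟩ ⟨⟨s', i'⟩, t'⟩ hp
    simp only [Prod.mk.injEq, Fin.mk.injEq] at hp
    have h1 : ((s : ℕ) * q + t) / q = s := by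
      rw [mul_comm, Nat.mul_add_div t.pos, Nat.div_eq_of_lt t.2, add_zero]
    have h2 : ((s' : ℕ) * q + t') / q = s' := by
      rw [mul_comm, Nat.mul_add_div t.pos, Nat.div_eq_of_lt t'.2, add_zero]
    have hs : (s : ℕ) = s' := by rw [← h1, hp.1, h2]
    rw [hs] at hp
    simp only [Prod.mk.injEq]
    exact ⟨⟨Fin.ext hs, hp.2⟩, Fin.ext (by lia)⟩
  exact iIndepFun_curry (X := fun (p : Fin K × Fin (n / k)) (t : Fin q) u =>
    batchRow (n := n) k d hKq p.1 p.2 u t)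
    (fun p t => (measurable_pi_apply t).comp (measurable_batchRow hKq p.1 p.2)) (h1.precomp hinj)

lemma map_batchRow (μ : Measure (EuclideanSpace ℝ (Fin n))) [IsProbabilityMeasure μ]
    (hKq : K * q ≤ M) (s : Fin K) (i : Fin (n / k)) :
    (Measure.pi fun _ : Fin M => μ).map (batchRow k d hKq s i) =
      Measure.pi fun _ : Fin q => μ.map fun x => row k d x i := by
  have hinj : Function.Injective fun t : Fin q => (⟨s * q + t, round_lt hKq s t⟩ : Fin M) :=
    fun t t' h => Fin.ext (by simpa using h)
  have h := (iIndepFun_pi (μ := fun _ : Fin M => μ) (X := fun _ x => row k d x i)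
    fun _ => (measurable_row k d i).aemeasurable).precomp hinj
  have hm' : ∀ t : Fin q, Measurable fun u : Fin M → EuclideanSpace ℝ (Fin n) =>
      row k d (u ⟨s * q + t, round_lt hKq s t⟩) i :=
    fun t => (measurable_row k d i).comp (measurable_pi_apply _)
  refine (h.map_fun_eq_pi_map fun t => (hm' t).aemeasurable).trans ?_
  congr 1
  ext1 t
  have hm := measurePreserving_eval (fun _ : Fin M => μ) ⟨s * q + t, round_lt hKq s t⟩
  conv_rhs => rw [← hm.map_eq, Measure.map_map (measurable_row k d i) hm.measurable]
  rfl

end Batches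

/-! ### Survival of independent rows through K steps. -/

section Thresholding

variable {Ω : Type*} [MeasurableSpace Ω] {P : Measure Ω} {K N : ℕ} {e : Fin K → Fin N → Ω → Prop}

lemma measure_forall_lt_le
    (he : iIndepFun (fun p : Fin K × Fin N => e p.1 p.2) P) {i : Fin N}
    (hi : ∀ s, P {ω | e s i ω} ≤ 1 / 2) {r : ℕ} (hr : r ≤ K) :
    P {ω | ∀ s : Fin K, (s : ℕ) < r → e s i ω} ≤ (1 / 2) ^ r := by
  have h := he.precomp (g := fun s => (s, i)) fun a b hab => (Prod.ext_iff.1 hab).1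
  have hS : ∀ s, e s i ⁻¹' {True} = {ω | e s i ω} := fun s => by ext; simp
  have hset : {ω | ∀ s : Fin K, (s : ℕ) < r → e s i ω} =
      ⋂ s ∈ Finset.univ.filter fun s : Fin K => (s : ℕ) < r, {ω | e s i ω} := by
    ext
    simp
  rw [hset, h.meas_biInter (S := Finset.univ.filter fun s : Fin K => (s : ℕ) < r)
    fun s _ => ⟨{True}, measurableSet_singleton _, hS s⟩]
  refine (Finset.prod_le_prod' fun s _ => hi s).trans ?_
  rw [Finset.prod_const, Fin.card_filter_val_lt, min_eq_right hr]

lemma measure_exists_forall_le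
    (he : iIndepFun (fun p : Fin K × Fin N => e p.1 p.2) P)
    (hi : ∀ s i, P {ω | e s i ω} ≤ 1 / 2) :
    P {ω | ∃ i, ∀ s, e s i ω} ≤ N * (1 / 2) ^ K := by
  rw [Set.ofPred_exists]
  refine (measure_iUnion_fintype_le _ _).trans ?_
  refine (Finset.sum_le_sum (g := fun _ => (1 / 2 : ℝ≥0∞) ^ K) fun i _ => ?_).trans_eq (by simp)
  simpa using measure_forall_lt_le he (fun s => hi s i) le_rfl

lemma measure_not_forall_le {j : Fin N} {η : ℝ≥0∞} (hj : ∀ s, P {ω | ¬ e s j ω} ≤ η) :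
    P {ω | ¬ ∀ s, e s j ω} ≤ K * η := by
  simp only [not_forall]
  rw [Set.ofPred_exists]
  refine (measure_iUnion_fintype_le _ _).trans ?_
  exact (Finset.sum_le_sum fun s _ => hj s).trans_eq (by simp)

open Classical in
/-- The number of indices `r ≤ K` such that the first `r` entries of `f` hold. -/
noncomputable def runLength (f : Fin K → Prop) : ℝ :=
  ∑ r ∈ Finset.range (K + 1), if ∀ s : Fin K, (s : ℕ) < r → f s then 1 else 0

lemma runLength_nonneg (f : Fin K → Prop) : 0 ≤ runLength f :=
  Finset.sum_nonneg fun r _ => by split_ifs <;> norm_num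

lemma runLength_le (f : Fin K → Prop) : runLength f ≤ K + 1 := by
  refine (Finset.sum_le_sum fun r _ => (?_ : _ ≤ (1 : ℝ))).trans (by simp)
  split_ifs <;> norm_num

/-- Bounds the second moment of a survival time linearly in the survival indicators, whose
expectations decay geometrically. -/
lemma sq_sum_le {x : ℕ → ℝ} (hx : ∀ r, x r = 0 ∨ x r = 1) (m : ℕ) :
    (∑ r ∈ Finset.range m, x r) ^ 2 ≤ ∑ r ∈ Finset.range m, 2 * (r + 1) * x r := by
  induction m with
  | zero => simp
  | succ m ih =>
    rw [Finset.sum_range_succ, Finset.sum_range_succ]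
    have hS : ∑ r ∈ Finset.range m, x r ≤ m := by
      refine (Finset.sum_le_sum fun r _ => (?_ : x r ≤ 1)).trans (by simp)
      rcases hx r with h | h <;> norm_num [h]
    rcases hx m with h | h <;> rw [h] <;> nlinarith

lemma sum_half_pow_le (m : ℕ) : ∑ r ∈ Finset.range m, (1 / 2 : ℝ) ^ r ≤ 2 := by
  have h : ∑ r ∈ Finset.range m, (1 / 2 : ℝ) ^ r = 2 - 2 * (1 / 2) ^ m := by
    induction m with
    | zero => simp
    | succ m ih => rw [Finset.sum_range_succ, ih, pow_succ]; ring
  rw [h]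
  linarith [pow_pos (show (0 : ℝ) < 1 / 2 by norm_num) m]

lemma sum_mul_half_pow_le (m : ℕ) :
    ∑ r ∈ Finset.range m, 2 * ((r : ℝ) + 1) * (1 / 2 : ℝ) ^ r ≤ 8 := by
  have h : ∑ r ∈ Finset.range m, 2 * ((r : ℝ) + 1) * (1 / 2 : ℝ) ^ r =
      8 - (4 * m + 8) * (1 / 2) ^ m := by
    induction m with
    | zero => simp
    | succ m ih => rw [Finset.sum_range_succ, ih, pow_succ]; push_cast; ring
  rw [h]
  have : 0 ≤ (4 * (m : ℝ) + 8) * (1 / 2) ^ m := by positivity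
  linarith

lemma measurable_runLength (me : ∀ s i, Measurable (e s i)) (i : Fin N) :
    Measurable fun ω => runLength fun s => e s i ω :=
  (Measurable.of_discrete (f := runLength (K := K))).comp (measurable_pi_lambda _ fun s => me s i)

variable [IsProbabilityMeasure P]

lemma memLp_runLength (me : ∀ s i, Measurable (e s i)) (i : Fin N) :
    MemLp (fun ω => runLength fun s => e s i ω) 2 P :=
  MemLp.of_bound (measurable_runLength me i).aestronglyMeasurable (K + 1)
    (ae_of_all _ fun ω => by
      rw [Real.norm_of_nonneg (runLength_nonneg _)]
      exact runLength_le _)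

-- The weight 1 gives the mean of the run length; the weight 2(r + 1) bounds its second moment
-- through `sq_sum_le`.
open Classical in
lemma integral_weighted_run_le (me : ∀ s i, Measurable (e s i))
    (he : iIndepFun (fun p : Fin K × Fin N => e p.1 p.2) P) {i : Fin N}
    (hi : ∀ s, P {ω | e s i ω} ≤ 1 / 2) {w : ℕ → ℝ} (hw : ∀ r, 0 ≤ w r) :
    ∫ ω, ∑ r ∈ Finset.range (K + 1),
      w r * (if ∀ s : Fin K, (s : ℕ) < r → e s i ω then 1 else 0) ∂P ≤
      ∑ r ∈ Finset.range (K + 1), w r * (1 / 2) ^ r := by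
  have hmeas : ∀ r : ℕ, MeasurableSet {ω | ∀ s : Fin K, (s : ℕ) < r → e s i ω} := fun r =>
    measurableSet_setOfPred.2 (Measurable.forall fun s => measurable_const.imp (me s i))
  have hind : ∀ r : ℕ, (fun ω => if ∀ s : Fin K, (s : ℕ) < r → e s i ω then (1 : ℝ) else 0) =
      {ω | ∀ s : Fin K, (s : ℕ) < r → e s i ω}.indicator 1 := fun r => by
    ext ω
    simp [Set.indicator_apply]
  have hint : ∀ r : ℕ, Integrable
      (fun ω => if ∀ s : Fin K, (s : ℕ) < r → e s i ω then (1 : ℝ) else 0) P := fun r => by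
    rw [hind]
    exact (integrable_const (1 : ℝ)).indicator (hmeas r)
  rw [integral_finsetSum _ fun r _ => (hint r).const_mul _]
  refine Finset.sum_le_sum fun r hr => ?_
  rw [integral_const_mul, hind, integral_indicator_one (hmeas r)]
  refine mul_le_mul_of_nonneg_left ?_ (hw r)
  have h := measure_forall_lt_le he hi (Nat.lt_succ_iff.1 (Finset.mem_range.1 hr))
  have h2 := ENNReal.toReal_mono (by finiteness) h
  simpa [Measure.real] using h2

lemma integral_runLength_le (me : ∀ s i, Measurable (e s i))
    (he : iIndepFun (fun p : Fin K × Fin N => e p.1 p.2) P) {i : Fin N}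
    (hi : ∀ s, P {ω | e s i ω} ≤ 1 / 2) :
    ∫ ω, runLength (fun s => e s i ω) ∂P ≤ 2 := by
  have h := integral_weighted_run_le me he hi (w := fun _ => 1) (by simp)
  simp only [one_mul] at h
  exact h.trans (sum_half_pow_le _)

lemma variance_runLength_le (me : ∀ s i, Measurable (e s i))
    (he : iIndepFun (fun p : Fin K × Fin N => e p.1 p.2) P) {i : Fin N}
    (hi : ∀ s, P {ω | e s i ω} ≤ 1 / 2) :
    Var[fun ω => runLength fun s => e s i ω; P] ≤ 8 := by
  classical
  refine (variance_le_expectation_sq (measurable_runLength me i).aestronglyMeasurable).trans ?_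
  have h := integral_weighted_run_le me he hi (w := fun r => 2 * ((r : ℝ) + 1))
    fun r => by positivity
  refine le_trans (integral_mono_ae (memLp_runLength me i).integrable_sq ?_
    (ae_of_all _ fun ω => sq_sum_le (fun r => ?_) _)) (h.trans (sum_mul_half_pow_le _))
  · refine integrable_finsetSum _ fun r _ => Integrable.const_mul ?_ _
    have hmeas : MeasurableSet {ω | ∀ s : Fin K, (s : ℕ) < r → e s i ω} :=
      measurableSet_setOfPred.2 (Measurable.forall fun s => measurable_const.imp (me s i))
    refine ((integrable_const (1 : ℝ)).indicator hmeas).congr (ae_of_all _ fun ω => ?_)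
    simp [Set.indicator_apply]
  · split_ifs <;> simp

open Classical in
/-- By Chebyshev's inequality, it is unlikely that the sets of survivors are large, if all rows
but one survive each step with probability at most one half. -/
lemma measure_lt_sum_card_le (me : ∀ s i, Measurable (e s i))
    (he : iIndepFun (fun p : Fin K × Fin N => e p.1 p.2) P) {j : Fin N}
    (hi : ∀ i ≠ j, ∀ s, P {ω | e s i ω} ≤ 1 / 2) (hK : K + 1 < 2 * N) :
    P {ω | 4 * N < ∑ r ∈ Finset.range (K + 1),
      (Finset.univ.filter fun i => ∀ s : Fin K, (s : ℕ) < r → e s i ω).card} ≤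
      ENNReal.ofReal (8 * N / (2 * N - (K + 1)) ^ 2) := by
  set T : Fin N → Ω → ℝ := fun i ω => runLength fun s => e s i ω with hT
  have hK' : ((K : ℝ) + 1) < 2 * N := by exact_mod_cast hK
  -- Collecting all steps of a row into one variable makes the run lengths independent across rows.
  have hcurry : iIndepFun (fun i ω s => e s i ω) P :=
    iIndepFun_curry (X := fun i s => e s i) (fun i s => me s i)
      (he.precomp (g := Prod.swap) Prod.swap_injective)
  have hTind : iIndepFun T P :=
    hcurry.comp (fun _ => runLength) fun _ => Measurable.of_discrete
  have hLp : ∀ i, MemLp (T i) 2 P := memLp_runLength me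
  have hvar : Var[∑ i ∈ Finset.univ.erase j, T i; P] ≤ 8 * N := by
    rw [IndepFun.variance_sum (fun i _ => hLp i) fun i _ i' _ hii => hTind.indepFun hii]
    refine (Finset.sum_le_sum fun i hij =>
      variance_runLength_le me he (hi i (Finset.ne_of_mem_erase hij))).trans ?_
    rw [Finset.sum_const, nsmul_eq_mul, mul_comm]
    have : (Finset.univ.erase j).card ≤ N := (Finset.card_le_univ _).trans (by simp)
    gcongr
  have hmean : ∫ ω, (∑ i ∈ Finset.univ.erase j, T i) ω ∂P ≤ (2 * N : ℝ) := by
    simp only [Finset.sum_apply]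
    rw [integral_finsetSum _ fun i _ => (hLp i).integrable (by norm_num)]
    refine (Finset.sum_le_sum fun i hij =>
      integral_runLength_le me he (hi i (Finset.ne_of_mem_erase hij))).trans ?_
    rw [Finset.sum_const, nsmul_eq_mul, mul_comm]
    have : (Finset.univ.erase j).card ≤ N := (Finset.card_le_univ _).trans (by simp)
    gcongr
  have hcheb := meas_ge_le_variance_div_sq (μ := P) (X := ∑ i ∈ Finset.univ.erase j, T i)
    (memLp_finsetSum' _ fun i _ => hLp i) (c := 2 * N - (K + 1)) (by linarith)
  refine (measure_mono fun ω hω => ?_).trans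
    (hcheb.trans (ENNReal.ofReal_le_ofReal (div_le_div_of_nonneg_right hvar (sq_nonneg _))))
  have hcard : ((∑ r ∈ Finset.range (K + 1),
      (Finset.univ.filter fun i => ∀ s : Fin K, (s : ℕ) < r → e s i ω).card : ℕ) : ℝ) =
      ∑ i, T i ω := by
    push_cast [Finset.card_filter]
    rw [Finset.sum_comm]
    rfl
  have hω' : (4 * N : ℝ) < ∑ i, T i ω := by
    rw [← hcard]
    exact_mod_cast hω
  rw [← Finset.add_sum_erase _ _ (Finset.mem_univ j)] at hω'
  -- Nothing is assumed about survival of row `j`, so it is bounded deterministically; the other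
  -- rows must then exceed their mean bound 2N by 2N - (K + 1).
  have hj : T j ω ≤ K + 1 := runLength_le _
  change (2 * N - (K + 1) : ℝ) ≤ |_|
  refine le_trans ?_ (le_abs_self _)
  rw [Finset.sum_apply]
  linarith

end Thresholding

/-! ### Combinatorics of survivors and termination. -/

section Survivors

variable {N d q : ℕ} {L : (Fin q → EuclideanSpace ℝ (Fin d)) → ℝ} {γ : ℝ}
  {z z' : ℕ → Fin N → EuclideanSpace ℝ (Fin d)}

lemma mem_survivors {r : ℕ} {i : Fin N} :
    i ∈ survivors q L γ z r ↔ ∀ s < r, γ < L fun t => z (s * q + (t : ℕ)) i := by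
  induction r with
  | zero => simp [survivors]
  | succ r ih => simp only [survivors, Finset.mem_filter, ih, Nat.forall_lt_succ_right]

lemma survivors_congr {r : ℕ} (h : ∀ s < r, ∀ t < q, ∀ i ∈ survivors q L γ z s,
    z (s * q + t) i = z' (s * q + t) i) : survivors q L γ z r = survivors q L γ z' r := by
  induction r with
  | zero => rfl
  | succ r ih =>
    rw [survivors, survivors, ← ih fun s hs => h s (by lia)]
    refine Finset.filter_congr fun i hi => ?_
    have : (fun t : Fin q => z (r * q + t) i) = fun t : Fin q => z' (r * q + t) i :=
      funext fun t => h r (by lia) t t.2 i hi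
    rw [this]

lemma terminated_congr {S S' : ℕ → Finset (Fin N)} {r : ℕ} (h : ∀ s ≤ r, S s = S' s) :
    Terminated S r ↔ Terminated S' r := by
  rw [Terminated, Terminated, Finset.sum_congr rfl fun s hs => by
    rw [h s (Nat.lt_succ_iff.1 (Finset.mem_range.1 hs))]]

lemma Terminated.mono {S : ℕ → Finset (Fin N)} {r r' : ℕ} (hr : r ≤ r') (h : Terminated S r) :
    Terminated S r' :=
  lt_of_lt_of_le h (Finset.sum_le_sum_of_subset (Finset.range_mono (by lia)))

-- Non-termination at the last index bounds the entire sum; if that index has terminated, its term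
-- is zero and the induction hypothesis suffices.
open Classical in
lemma sum_card_not_terminated_le (S : ℕ → Finset (Fin N)) (K : ℕ) :
    ∑ r ∈ Finset.range K, (if ¬ Terminated S r then (S r).card else 0) ≤ 4 * N := by
  induction K with
  | zero => simp
  | succ K ih =>
    by_cases h : Terminated S K
    · rw [Finset.sum_range_succ, if_neg (by simpa using h), add_zero]
      exact ih
    · refine le_trans (Finset.sum_le_sum fun r _ => ?_) (not_lt.1 h)
      split_ifs <;> simp

lemma sum_range_mul_div (q K : ℕ) (f : ℕ → ℕ) :
    ∑ t ∈ Finset.range (K * q), f (t / q) = q * ∑ r ∈ Finset.range K, f r := by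
  induction K with
  | zero => simp
  | succ K ih =>
    rw [add_mul, one_mul, Finset.sum_range_add, ih, Finset.sum_range_succ, mul_add]
    congr 1
    rw [Finset.sum_congr rfl fun t ht => by
      rw [mul_comm K q, Nat.mul_add_div (by have := Finset.mem_range.1 ht; lia),
        Nat.div_eq_of_lt (Finset.mem_range.1 ht), add_zero]]
    simp

end Survivors

/-! ### Budget, and equivalence with thresholding of the full samples. -/

section Procedure

variable {n k M : ℕ} {ρ ε : ℝ}

lemma card_block_le (n k d j : ℕ) : (block n k d j).card ≤ d := by
  have h := Finset.card_le_card_of_injOn (s := block n k d j) (t := Finset.Ico (j * k) (j * k + d))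
    (fun i => (i : ℕ)) (fun i hi => by simpa using mem_block.1 hi)
    (fun a _ b _ hab => Fin.ext hab)
  simpa using h

lemma row_mask {d : ℕ} {A : Finset (Fin n)} {j : ℕ} (h : block n k d j ⊆ A)
    (x : EuclideanSpace ℝ (Fin n)) : row k d (mask A x) j = row k d x j := by
  ext i
  simp only [row, mask]
  split_ifs with h1 h2
  · rfl
  · exact absurd (h (mem_block.2 ⟨by simp, by simp⟩)) h2
  · rfl

lemma history_eq (π : AdaptiveProcedure n M) (u : Fin M → EuclideanSpace ℝ (Fin n)) (t : Fin M) :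
    π.history u t = (π.query t fun s : Fin t => π.history u ⟨s, s.2.trans t.2⟩,
      mask (π.query t fun s : Fin t => π.history u ⟨s, s.2.trans t.2⟩) (u t)) := by
  rw [AdaptiveProcedure.history]

/-- The sets of survivors as determined by a full history. -/
noncomputable def recordedSurvivors (k : ℕ) (ρ : ℝ) (h : Fin M → Obs n) :
    ℕ → Finset (Fin (n / k)) :=
  stSurvivors k (keep k ρ) (batch n k M (keep k ρ)) ρ (padded h)

/-- The sets of survivors as determined by the complete, unmasked sample vectors. -/
noncomputable def fullSurvivors (k : ℕ) (ρ : ℝ) (u : Fin M → EuclideanSpace ℝ (Fin n)) :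
    ℕ → Finset (Fin (n / k)) :=
  stSurvivors k (keep k ρ) (batch n k M (keep k ρ)) ρ fun s => if hs : s < M then u ⟨s, hs⟩ else 0

-- The query is decided on a partial history, but the survivors at step `t / q` depend only on
-- rounds before `(t / q) * q ≤ t`, so the full history gives the same answer.
open Classical in
lemma modifiedST_history_fst (u : Fin M → EuclideanSpace ℝ (Fin n)) (t : Fin M) :
    ((modifiedST n k M ρ ε).history u t).1 =
      if (t : ℕ) < numSteps ε (n / k) * batch n k M (keep k ρ) ∧
        ¬ Terminated (recordedSurvivors k ρ ((modifiedST n k M ρ ε).history u))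
          ((t : ℕ) / batch n k M (keep k ρ)) then
        (recordedSurvivors k ρ ((modifiedST n k M ρ ε).history u)
          ((t : ℕ) / batch n k M (keep k ρ))).biUnion fun j => block n k (keep k ρ) j
      else ∅ := by
  rw [history_eq]
  set q := batch n k M (keep k ρ) with hq
  set H := (modifiedST n k M ρ ε).history u with hH
  have hS : ∀ r ≤ (t : ℕ) / q, stSurvivors k (keep k ρ) q ρ
      (padded fun s : Fin t => H ⟨s, s.2.trans t.2⟩) r = recordedSurvivors k ρ H r := by
    intro r hr
    refine survivors_congr fun s hs t' ht' i _ => ?_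
    have h1 : s * q + t' < t := by
      have h2 := Nat.mul_le_mul_right q (show s + 1 ≤ (t : ℕ) / q by lia)
      have h3 := Nat.div_mul_le_self t q
      rw [add_mul] at h2
      lia
    simp only [padded, dif_pos h1, dif_pos (h1.trans t.2)]
  simp only [modifiedST]
  rw [← hq, hS _ le_rfl, terminated_congr hS]

lemma budget_modifiedST (u : Fin M → EuclideanSpace ℝ (Fin n)) :
    ∑ t, ((modifiedST n k M ρ ε).history u t).1.card ≤ M := by
  classical
  set d := keep k ρ with hd
  set q := batch n k M d with hq
  set S := recordedSurvivors k ρ ((modifiedST n k M ρ ε).history u) with hS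
  set K := numSteps ε (n / k) with hK
  let g : ℕ → ℕ := fun r => d * (if ¬ Terminated S r then (S r).card else 0)
  have h1 : ∀ t : Fin M, ((modifiedST n k M ρ ε).history u t).1.card ≤
      if (t : ℕ) < K * q then g (t / q) else 0 := fun t => by
    rw [modifiedST_history_fst]
    by_cases hlt : (t : ℕ) < K * q
    · by_cases hT : Terminated S (t / q)
      · rw [if_neg (fun h => h.2 hT)]
        simp
      · rw [if_pos ⟨hlt, hT⟩, if_pos hlt]
        simp only [g, if_pos hT]
        refine Finset.card_biUnion_le.trans ((Finset.sum_le_sum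
          fun (j : Fin (n / k)) _ => card_block_le n k d j).trans ?_)
        rw [Finset.sum_const, smul_eq_mul, mul_comm]
    · rw [if_neg (fun h => hlt h.1)]
      simp
  calc ∑ t, ((modifiedST n k M ρ ε).history u t).1.card
      ≤ ∑ t : Fin M, if (t : ℕ) < K * q then g (t / q) else 0 := Finset.sum_le_sum fun t _ => h1 t
    _ = ∑ t ∈ Finset.range M, if t < K * q then g (t / q) else 0 :=
        Fin.sum_univ_eq_sum_range (fun t => if t < K * q then g (t / q) else 0) M
    _ = ∑ t ∈ (Finset.range M).filter (· < K * q), g (t / q) := (Finset.sum_filter _ _).symm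
    _ ≤ ∑ t ∈ Finset.range (K * q), g (t / q) := Finset.sum_le_sum_of_subset fun t ht => by
        simpa using (Finset.mem_filter.1 ht).2
    _ = q * (d * ∑ r ∈ Finset.range K, if ¬ Terminated S r then (S r).card else 0) := by
        rw [sum_range_mul_div]
        exact congrArg _ (Finset.mul_sum _ _ _).symm
    _ ≤ q * (d * (4 * (n / k))) := by
        gcongr
        exact sum_card_not_terminated_le S K
    _ = q * 4 * (n / k * d) := by ring
    _ ≤ M / (n / k * d) * (n / k * d) := Nat.mul_le_mul_right _ (Nat.div_mul_le_self _ 4)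
    _ ≤ M := Nat.div_mul_le_self _ _

/-- By strong induction: if the survivors agree so far and termination has not occurred, every
surviving row is queried in full, so masking does not alter the data that decide the next step. -/
lemma recordedSurvivors_eq (hKq : numSteps ε (n / k) * batch n k M (keep k ρ) ≤ M)
    (u : Fin M → EuclideanSpace ℝ (Fin n)) {r : ℕ} (hr : r ≤ numSteps ε (n / k))
    (hT : ∀ s < r, ¬ Terminated (fullSurvivors k ρ u) s) :
    ∀ s ≤ r, fullSurvivors k ρ u s =
      recordedSurvivors k ρ ((modifiedST n k M ρ ε).history u) s := by
  intro s
  induction s using Nat.strong_induction_on with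
  | _ s ih =>
  intro hs
  refine survivors_congr fun s' hs' t ht i hi => ?_
  set q := batch n k M (keep k ρ) with hq
  have hlt : s' * q + t < numSteps ε (n / k) * q := by
    have h2 := Nat.mul_le_mul_right q (show s' + 1 ≤ numSteps ε (n / k) by lia)
    rw [add_mul] at h2
    lia
  have hdiv : (s' * q + t) / q = s' := by
    rw [mul_comm, Nat.mul_add_div (by lia), Nat.div_eq_of_lt ht, add_zero]
  have hltM := hlt.trans_le hKq
  have heq := ih s' hs' (by lia)
  have hi' : i ∈ recordedSurvivors k ρ ((modifiedST n k M ρ ε).history u) s' := by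
    rw [← heq]
    exact hi
  have hT' : ¬ Terminated (recordedSurvivors k ρ ((modifiedST n k M ρ ε).history u)) s' := by
    rw [← terminated_congr fun s'' hs'' => ih s'' (by lia) (by lia)]
    exact hT s' (by lia)
  simp only [padded, dif_pos hltM]
  rw [history_eq]
  refine (row_mask ?_ _).symm
  have hfst := modifiedST_history_fst (ρ := ρ) (ε := ε) (k := k) u ⟨s' * q + t, hltM⟩
  rw [history_eq, if_pos ⟨hlt, by
    change ¬ Terminated _ ((s' * q + t) / q)
    rwa [hdiv]⟩] at hfst
  refine Finset.Subset.trans ?_ (Finset.Subset.antisymm_iff.1 hfst).2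
  change _ ⊆ Finset.biUnion (recordedSurvivors k ρ _ ((s' * q + t) / q)) _
  rw [hdiv]
  exact Finset.subset_biUnion_of_mem (fun j : Fin (n / k) => block n k (keep k ρ) j) hi'

lemma modifiedST_test_history (hKq : numSteps ε (n / k) * batch n k M (keep k ρ) ≤ M)
    (u : Fin M → EuclideanSpace ℝ (Fin n)) :
    (modifiedST n k M ρ ε).test ((modifiedST n k M ρ ε).history u) = true ↔
      ¬ Terminated (fullSurvivors k ρ u) (numSteps ε (n / k)) ∧
        (fullSurvivors k ρ u (numSteps ε (n / k))).Nonempty := by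
  classical
  have htest : (modifiedST n k M ρ ε).test ((modifiedST n k M ρ ε).history u) = true ↔
      ¬ Terminated (recordedSurvivors k ρ ((modifiedST n k M ρ ε).history u))
        (numSteps ε (n / k)) ∧
        (recordedSurvivors k ρ ((modifiedST n k M ρ ε).history u)
          (numSteps ε (n / k))).Nonempty := by
    conv_lhs => simp only [modifiedST]
    rw [decide_eq_true_iff]
    rfl
  rw [htest]
  by_cases hT : ∃ s < numSteps ε (n / k), Terminated (fullSurvivors k ρ u) s
  -- The two versions agree up to and including the first step of termination, so both are
  -- terminated from there on and neither rejects.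
  · have hs := Nat.find_spec hT
    have hmin : ∀ s < Nat.find hT, ¬ Terminated (fullSurvivors k ρ u) s := fun s hlt h =>
      Nat.find_min hT hlt ⟨hlt.trans hs.1, h⟩
    have heq := recordedSurvivors_eq hKq u hs.1.le hmin
    have h1 := hs.2.mono hs.1.le
    have h2 := ((terminated_congr heq).1 hs.2).mono hs.1.le
    exact ⟨fun h => absurd h2 h.1, fun h => absurd h1 h.1⟩
  · push Not at hT
    have heq := recordedSurvivors_eq hKq u le_rfl hT
    rw [terminated_congr heq, heq _ le_rfl]

end Procedure

/-! ### Admissibility of the procedure. -/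

section Measurability

variable {n k M : ℕ} {ρ ε : ℝ}

lemma measurable_padded {T : ℕ} (s : ℕ) : Measurable fun h : Fin T → Obs n => padded h s := by
  unfold padded
  split_ifs <;> fun_prop

lemma measurable_mem_stSurvivors {T : ℕ} (k d q : ℕ) (ρ : ℝ) (r : ℕ) (i : Fin (n / k)) :
    Measurable fun h : Fin T → Obs n => i ∈ stSurvivors k d q ρ (padded h) r := by
  unfold stSurvivors
  simp only [mem_survivors]
  refine Measurable.forall fun s => measurable_const.imp ?_
  refine measurableSet_setOfPred.1 (measurableSet_lt measurable_const ?_)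
  exact (measurable_rowStat d q ρ).comp (measurable_pi_lambda _ fun t =>
    (measurable_row k d i).comp (measurable_padded _))

lemma measurable_terminated {Ω : Type*} [MeasurableSpace Ω] {N : ℕ} {S : Ω → ℕ → Finset (Fin N)}
    (hS : ∀ r i, Measurable fun ω => i ∈ S ω r) (r : ℕ) :
    Measurable fun ω => Terminated (S ω) r := by
  classical
  unfold Terminated
  refine measurableSet_setOfPred.1 (measurableSet_lt measurable_const ?_)
  refine Finset.measurable_sum _ fun s _ => ?_
  have : (fun ω => (S ω s).card) = fun ω => ∑ i : Fin N, if i ∈ S ω s then 1 else 0 := by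
    ext ω
    simp
  rw [this]
  exact Finset.measurable_sum _ fun i _ =>
    Measurable.ite (measurableSet_setOfPred.2 (hS s i)) measurable_const measurable_const

lemma isAdmissible_modifiedST (n k M : ℕ) (ρ ε : ℝ) : (modifiedST n k M ρ ε).IsAdmissible where
  measurable_query t := by
    rw [measurable_finset_iff]
    intro a
    simp only [modifiedST]
    have h := measurable_mem_stSurvivors (n := n) (T := t) k (keep k ρ)
      (batch n k M (keep k ρ)) ρ
    have hT := measurable_terminated h
    have hiff : ∀ (p : Prop) [Decidable p] (A : Finset (Fin n)),
        (a ∈ if p then A else ∅) ↔ p ∧ a ∈ A := fun p _ A => by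
      split_ifs with hp <;> simp [hp]
    simp only [hiff, Finset.mem_biUnion]
    exact (measurable_const.and (hT _).not).and
      (Measurable.exists fun j => (h _ j).and measurable_const)
  measurable_test := by
    have h := measurable_mem_stSurvivors (n := n) (T := M) k (keep k ρ)
      (batch n k M (keep k ρ)) ρ
    have hT := measurable_terminated h
    refine measurable_to_bool ?_
    have : (modifiedST n k M ρ ε).test ⁻¹' {true} = {x | ¬ Terminated (recordedSurvivors k ρ x)
        (numSteps ε (n / k)) ∧ ∃ i, i ∈ recordedSurvivors k ρ x (numSteps ε (n / k))} := by
      ext x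
      simp only [modifiedST, Set.mem_preimage, Set.mem_singleton_iff, decide_eq_true_iff]
      rfl
    rw [this]
    exact measurableSet_setOfPred.2 ((hT _).not.and (Measurable.exists fun i => h _ i))
  budget := budget_modifiedST

end Measurability

/-! ### Non-asymptotic risk bound. -/

section RiskBound

variable {n k M : ℕ} {ρ ε : ℝ}

lemma keep_le (k : ℕ) (ρ : ℝ) : keep k ρ ≤ k := min_le_left _ _

/-- Row `i` survives step `s`. -/
def stepEvent (ρ : ℝ) {q K : ℕ} (hKq : K * q ≤ M) (s : Fin K) (i : Fin (n / k))
    (u : Fin M → EuclideanSpace ℝ (Fin n)) : Prop :=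
  threshold (keep k ρ) q ρ < rowStat (keep k ρ) q ρ (batchRow k (keep k ρ) hKq s i u)

lemma measurableSet_exceed (d q : ℕ) (ρ : ℝ) :
    MeasurableSet {z | threshold d q ρ < rowStat d q ρ z} :=
  measurableSet_lt measurable_const (measurable_rowStat d q ρ)

lemma measurable_stepEvent {q K : ℕ} (hKq : K * q ≤ M) (s : Fin K) (i : Fin (n / k)) :
    Measurable (stepEvent (n := n) ρ hKq s i) :=
  measurableSet_setOfPred.1
    (measurable_batchRow hKq s i (measurableSet_exceed (keep k ρ) q ρ))

lemma mem_fullSurvivors {K : ℕ} (hKq : K * batch n k M (keep k ρ) ≤ M)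
    (u : Fin M → EuclideanSpace ℝ (Fin n)) {r : ℕ} (hr : r ≤ K) (i : Fin (n / k)) :
    i ∈ fullSurvivors k ρ u r ↔ ∀ s : Fin K, (s : ℕ) < r → stepEvent ρ hKq s i u := by
  rw [fullSurvivors, stSurvivors, mem_survivors]
  have key : ∀ s : Fin K, (fun t : Fin (batch n k M (keep k ρ)) => row k (keep k ρ)
      (if hs : (s : ℕ) * batch n k M (keep k ρ) + t < M then
        u ⟨(s : ℕ) * batch n k M (keep k ρ) + t, hs⟩ else 0) i) =
      batchRow k (keep k ρ) hKq s i u := fun s => by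
    ext1 t
    rw [dif_pos (round_lt hKq s t), batchRow]
  constructor
  · intro h s hs
    have := h s hs
    rwa [key s] at this
  · intro h s hs
    have := h ⟨s, hs.trans_le hr⟩ hs
    rw [stepEvent, ← key] at this
    exact this

lemma iIndepFun_stepEvent {q K : ℕ} (hKq : K * q ≤ M) {S : Finset (Fin n)}
    (h : iIndepFun (fun (i : Fin (n / k)) x => row k (keep k ρ) x i) (sampleLaw ρ S)) :
    iIndepFun (fun p : Fin K × Fin (n / k) => stepEvent (n := n) ρ hKq p.1 p.2)
      (Measure.pi fun _ : Fin M => sampleLaw ρ S) :=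
  (iIndepFun_batchRow hKq h).comp
    (fun _ z => threshold (keep k ρ) q ρ < rowStat (keep k ρ) q ρ z)
    fun _ => measurableSet_setOfPred.1 (measurableSet_exceed (keep k ρ) q ρ)

lemma measure_stepEvent_le {q K : ℕ} (hKq : K * q ≤ M) {S : Finset (Fin n)} {i : Fin (n / k)}
    (h : (sampleLaw ρ S).map (fun x => row k (keep k ρ) x i) = sampleLaw ρ ∅) (s : Fin K) :
    (Measure.pi fun _ : Fin M => sampleLaw ρ S) {u | stepEvent ρ hKq s i u} ≤ 1 / 2 := by
  have h1 := map_batchRow (d := keep k ρ) (sampleLaw ρ S) hKq s i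
  rw [h] at h1
  have h2 := null_exceed_threshold_le (keep k ρ) q ρ
  rw [← h1, Measure.map_apply (measurable_batchRow hKq s i) (measurableSet_exceed _ _ _)] at h2
  exact h2

lemma measure_not_stepEvent_le (h0 : 0 ≤ ρ) (hρ : ρ < 1) {q K : ℕ} (hKq : K * q ≤ M)
    {S : Finset (Fin n)} {i : Fin (n / k)}
    (h : (sampleLaw ρ S).map (fun x => row k (keep k ρ) x i) = sampleLaw ρ Finset.univ)
    (s : Fin K) :
    (Measure.pi fun _ : Fin M => sampleLaw ρ S) {u | ¬ stepEvent ρ hKq s i u} ≤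
      ENNReal.ofReal (2 * sqAffinity (keep k ρ) ρ ^ q) := by
  have h1 := map_batchRow (d := keep k ρ) (sampleLaw ρ S) hKq s i
  rw [h] at h1
  have h2 := alt_le_threshold_le (keep k ρ) q h0 hρ
  rw [← h1, Measure.map_apply (measurable_batchRow hKq s i)
    (measurableSet_le (measurable_rowStat _ _ _) measurable_const)] at h2
  simp only [stepEvent, not_lt]
  exact h2

/-- A bound for the risk that holds for all sample sizes. -/
lemma risk_modifiedST_le (h0 : 0 ≤ ρ) (hρ : ρ < 1)
    (hKq : numSteps ε (n / k) * batch n k M (keep k ρ) ≤ M)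
    (hK : numSteps ε (n / k) + 1 < 2 * (n / k)) :
    (modifiedST n k M ρ ε).risk ρ (disjointIntervals n k) ≤
      ENNReal.ofReal ((n / k : ℕ) * (1 / 2) ^ numSteps ε (n / k)) +
        (ENNReal.ofReal (8 * (n / k : ℕ) / (2 * (n / k : ℕ) - (numSteps ε (n / k) + 1)) ^ 2) +
        ENNReal.ofReal (numSteps ε (n / k) *
          (2 * sqAffinity (keep k ρ) ρ ^ batch n k M (keep k ρ)))) := by
  classical
  set K := numSteps ε (n / k) with hKdef
  set q := batch n k M (keep k ρ) with hq
  have hdk := keep_le k ρ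
  have hsurv : ∀ u : Fin M → EuclideanSpace ℝ (Fin n), ∀ r ≤ K, fullSurvivors k ρ u r =
      Finset.univ.filter fun i => ∀ s : Fin K, (s : ℕ) < r → stepEvent ρ hKq s i u :=
    fun u r hr => by
      ext i
      rw [mem_fullSurvivors hKq u hr]
      simp
  rw [AdaptiveProcedure.risk]
  refine add_le_add ?_ (iSup₂_le ?_)
  · have hind : iIndepFun (fun (i : Fin (n / k)) x => row k (keep k ρ) x i)
        (sampleLaw ρ (∅ : Finset (Fin n))) := iIndepFun_row h0 hρ.le _ hdk (by simp)
    have hmap : ∀ i : Fin (n / k), (sampleLaw ρ (∅ : Finset (Fin n))).map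
        (fun x => row k (keep k ρ) x i) = sampleLaw ρ ∅ := fun i =>
      map_row_sampleLaw h0 hρ.le _ hdk i _ (by simp)
    have h := measure_exists_forall_le (iIndepFun_stepEvent hKq hind)
      fun s i => measure_stepEvent_le hKq (hmap i) s
    refine (measure_mono fun u hu => ?_).trans (h.trans_eq ?_)
    · obtain ⟨-, i, hi⟩ := (modifiedST_test_history hKq u).1 hu
      exact ⟨i, fun s => (mem_fullSurvivors hKq u le_rfl i).1 hi s s.2⟩
    · rw [ENNReal.ofReal_mul (by positivity), ENNReal.ofReal_natCast,
        ENNReal.ofReal_pow (by norm_num), ENNReal.ofReal_div_of_pos (by norm_num),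
        ENNReal.ofReal_one, ENNReal.ofReal_ofNat]
  · rintro S ⟨j, rfl⟩
    have hind : iIndepFun (fun (i : Fin (n / k)) x => row k (keep k ρ) x i)
        (sampleLaw ρ (block n k k j)) := iIndepFun_row h0 hρ.le _ hdk fun i i' hii l l' hl => by
      rw [index_mem_block, index_mem_block] at hl
      exact hii (hl.1.trans hl.2.symm)
    have hmap : ∀ i ≠ j, (sampleLaw ρ (block n k k j)).map
        (fun x => row k (keep k ρ) x i) = sampleLaw ρ ∅ := fun i hi =>
      map_row_sampleLaw h0 hρ.le _ hdk i _ fun l => by simp [index_mem_block, hi]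
    have hmapj : (sampleLaw ρ (block n k k j)).map
        (fun x => row k (keep k ρ) x j) = sampleLaw ρ Finset.univ :=
      map_row_sampleLaw h0 hρ.le _ hdk j _ fun l => by simp [index_mem_block]
    have hterm := measure_lt_sum_card_le (fun s i => measurable_stepEvent hKq s i)
      (iIndepFun_stepEvent hKq hind)
      (fun i hi s => measure_stepEvent_le hKq (hmap i hi) s) hK
    have hmiss := measure_not_forall_le
      fun s => measure_not_stepEvent_le h0 hρ hKq hmapj s
    rw [← ENNReal.ofReal_natCast (n := K), ← ENNReal.ofReal_mul (by positivity)] at hmiss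
    refine (measure_mono fun u hu => ?_).trans
      ((measure_union_le _ _).trans (add_le_add hterm hmiss))
    -- A missed detection needs early termination or a failed step of row `j`; otherwise that row
    -- survives and the test rejects.
    by_contra hnot
    simp only [Set.mem_union, not_or, Set.mem_ofPred_eq, not_lt, not_not] at hnot
    have htrue := (modifiedST_test_history (ε := ε) hKq u).2 ⟨?_, j, ?_⟩
    · simp only [Set.mem_ofPred_eq] at hu
      rw [hu] at htrue
      exact Bool.false_ne_true htrue
    · rw [Terminated, not_lt]
      refine le_trans (Finset.sum_le_sum fun r hr => ?_) hnot.1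
      rw [hsurv u r (Nat.lt_succ_iff.1 (Finset.mem_range.1 hr))]
    · rw [mem_fullSurvivors hKq u le_rfl]
      exact fun s _ => hnot.2 s

end RiskBound

/-! ### Batch error in the two regimes. -/

section BatchError

variable {n k M : ℕ} {ρ : ℝ}

lemma sub_one_le_batch (n k M d : ℕ) :
    (M : ℝ) / ((n / k : ℕ) * d) / 4 - 1 ≤ batch n k M d := by
  have h : batch n k M d = ⌊(M : ℝ) / ((n / k : ℕ) * d * 4 : ℕ)⌋₊ := by
    rw [batch, Nat.div_div_eq_div_mul, Nat.floor_div_eq_div]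
  rw [h]
  have := (Nat.sub_one_lt_floor ((M : ℝ) / ((n / k : ℕ) * d * 4 : ℕ))).le
  refine le_trans (le_of_eq ?_) this
  push_cast
  rw [div_div]

lemma mul_batch_le {K : ℕ} (d : ℕ) (hK : K ≤ n / k) : K * batch n k M d ≤ M := by
  rcases Nat.eq_zero_or_pos d with rfl | hd
  · simp [batch]
  calc K * batch n k M d ≤ n / k * d * (M / (n / k * d)) :=
        Nat.mul_le_mul (hK.trans (Nat.le_mul_of_pos_right _ hd)) (Nat.div_le_self _ 4)
    _ ≤ M := Nat.mul_div_le _ _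

/-- Rounding the batch size down costs only the additive term c²/32 in the exponent, which stays
below 1 in both regimes. -/
lemma sqAffinity_pow_le (h0 : 0 < ρ) (h1 : ρ < 1) {m q : ℕ} {c y : ℝ} (hc : 0 ≤ c)
    (hcx : c ≤ m * ρ) (hx : m * ρ ≤ 2) (hq : y - 1 ≤ q) :
    sqAffinity (m + 1) ρ ^ q ≤ Real.exp (c ^ 2 / 32 - c ^ 2 / 32 * y) := by
  calc sqAffinity (m + 1) ρ ^ q ≤ Real.exp (-(m * ρ) ^ 2 / 32) ^ q :=
        pow_le_pow_left₀ (sqAffinity_pos h0.le h1 _).le (sqAffinity_le h0.le h1 m hx) q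
    _ = Real.exp (-((m * ρ) ^ 2 / 32 * q)) := by
        rw [← Real.exp_nat_mul]
        congr 1
        ring
    _ ≤ _ := by
        refine Real.exp_le_exp.2 ?_
        have h2 : c ^ 2 / 32 ≤ (m * ρ) ^ 2 / 32 := by gcongr
        have h3 : c ^ 2 / 32 * (y - 1) ≤ c ^ 2 / 32 * q :=
          mul_le_mul_of_nonneg_left hq (by positivity)
        have h4 : c ^ 2 / 32 * q ≤ (m * ρ) ^ 2 / 32 * q :=
          mul_le_mul_of_nonneg_right h2 (Nat.cast_nonneg q)
        linarith

lemma sqAffinity_pow_le_of_dense (hn : 0 < n) (hkn : k ∣ n) (h0 : 0 < ρ) (h1 : ρ ≤ 1 / 2)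
    (hρk : 1 ≤ ρ * k) {w : ℝ} (hw : 2048 * w ≤ ρ * k * ((M : ℝ) / n)) :
    sqAffinity (keep k ρ) ρ ^ batch n k M (keep k ρ) ≤ Real.exp (1 - 2 * w) := by
  have hk : 0 < k := Nat.pos_of_dvd_of_pos hkn hn
  have hceil : ⌈1 / ρ⌉₊ ≤ k := Nat.ceil_le.2 (by rw [div_le_iff₀ h0]; linarith)
  have hkeep : keep k ρ = ⌈1 / ρ⌉₊ := min_eq_right hceil
  obtain ⟨m, hm⟩ : ∃ m, ⌈1 / ρ⌉₊ = m + 1 :=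
    Nat.exists_eq_succ_of_ne_zero (Nat.ceil_pos.2 (by positivity)).ne'
  have hd1 : 1 / ρ ≤ m + 1 := by exact_mod_cast hm ▸ Nat.le_ceil (1 / ρ)
  have hd2 : (m + 1 : ℝ) < 1 / ρ + 1 := by
    exact_mod_cast hm ▸ Nat.ceil_lt_add_one (show 0 ≤ 1 / ρ by positivity)
  have hx1 : 1 ≤ (m + 1) * ρ := (div_le_iff₀ h0).1 hd1
  have hx2 : m * ρ < 1 := (lt_div_iff₀ h0).1 (by linarith)
  rw [hkeep, hm]
  have hy : 256 * w ≤ (M : ℝ) / ((n / k : ℕ) * (m + 1 : ℕ)) / 4 := by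
    rw [Nat.cast_div hkn (by positivity)]
    have hkr : (0 : ℝ) < k := by exact_mod_cast hk
    have hnr : (0 : ℝ) < n := by exact_mod_cast hn
    -- Rounding 1/ρ up at most doubles it: (m + 1)ρ < 1 + ρ ≤ 2.
    have h3 : ρ / 2 ≤ 1 / ((m : ℝ) + 1) := by
      rw [le_div_iff₀ (by positivity)]
      nlinarith
    have h4 : (M : ℝ) / (n / k * (m + 1 : ℕ)) / 4 = k * (M / n) / 4 * (1 / ((m : ℝ) + 1)) := by
      push_cast
      field_simp
    rw [h4]
    have h5 : k * ((M : ℝ) / n) / 4 * (ρ / 2) ≤ k * ((M : ℝ) / n) / 4 * (1 / ((m : ℝ) + 1)) :=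
      mul_le_mul_of_nonneg_left h3 (by positivity)
    linarith
  have hb := sub_one_le_batch n k M (m + 1)
  -- Here mρ ≥ 1 - ρ ≥ 1/2, so the rate is c²/32 = 1/128 and 256w observations give 2w. The constant
  -- 2048 is 256 · 8: a factor 4 from the batch and 2 from rounding.
  refine (sqAffinity_pow_le h0 (by linarith) (c := 1 / 2) (y := 256 * w) (by norm_num)
    (by linarith) (by linarith) (by linarith)).trans (Real.exp_le_exp.2 ?_)
  linarith

lemma sqAffinity_pow_le_of_sparse (hn : 0 < n) (hkn : k ∣ n) (hk : 2 ≤ k) (h0 : 0 < ρ)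
    (hρk : ρ * k ≤ 1) {w : ℝ} (hw0 : 0 ≤ w) (hw : 32 * √w ≤ ρ * k * √((M : ℝ) / n)) :
    sqAffinity (keep k ρ) ρ ^ batch n k M (keep k ρ) ≤ Real.exp (1 - 2 * w) := by
  have hkr : (2 : ℝ) ≤ k := by exact_mod_cast hk
  have hnr : (0 : ℝ) < n := by exact_mod_cast hn
  have hkeep : keep k ρ = k := by
    refine min_eq_left ?_
    have h : (k : ℝ) ≤ ⌈1 / ρ⌉₊ :=
      le_trans (by rw [le_div_iff₀ h0]; linarith) (Nat.le_ceil (1 / ρ))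
    exact_mod_cast h
  have hsq : 1024 * w ≤ (ρ * k) ^ 2 * (M / n) := by
    have h := pow_le_pow_left₀ (by positivity) hw 2
    rw [mul_pow, mul_pow (ρ * k), Real.sq_sqrt hw0, Real.sq_sqrt (by positivity)] at h
    linarith
  obtain ⟨m, rfl⟩ : ∃ m, k = m + 1 := Nat.exists_eq_succ_of_ne_zero (by lia)
  rw [hkeep]
  have hb := sub_one_le_batch n (m + 1) M (m + 1)
  have h4 : (M : ℝ) / ((n / (m + 1) : ℕ) * (m + 1 : ℕ)) / 4 = M / n / 4 := by
    rw [← Nat.cast_mul, Nat.div_mul_cancel hkn]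
  rw [h4] at hb
  push_cast at *
  have hm1 : (1 : ℝ) ≤ m := by linarith
  have hx : ρ * (m + 1) / 2 ≤ m * ρ := by nlinarith
  -- The rate (ρk)²/128 times M/(4n) is (ρk)²(M/n)/512, so 1024 = 32² is what produces 2w.
  refine (sqAffinity_pow_le h0 (by nlinarith) (c := ρ * (m + 1) / 2) (y := M / n / 4)
    (by positivity) hx (by nlinarith) hb).trans (Real.exp_le_exp.2 ?_)
  have h6 : (ρ * (m + 1)) ^ 2 ≤ 1 := pow_le_one₀ (by positivity) hρk
  generalize ρ * ((m : ℝ) + 1) = a at *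
  generalize (M : ℝ) / n = b at *
  linarith [show (a / 2) ^ 2 / 32 - (a / 2) ^ 2 / 32 * (b / 4) = a ^ 2 / 128 - a ^ 2 * b / 512 by
    ring]

end BatchError

/-! ### Limits of the three error terms. -/

section Asymptotics

lemma numSteps_le (ε : ℝ) (hε : 0 < ε) (N : ℕ) :
    (numSteps ε N : ℝ) ≤ (1 + ε) / Real.log 2 * Real.log N := by
  refine (Nat.floor_le (mul_nonneg (by linarith) ?_)).trans_eq ?_
  · exact div_nonneg (Real.log_natCast_nonneg N) (Real.log_nonneg (by norm_num))
  · rw [Real.logb]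
    ring

lemma eventually_numSteps_le (ε : ℝ) (hε : 0 < ε) : ∀ᶠ N : ℕ in atTop, numSteps ε N ≤ N := by
  have hlog2 : 0 < Real.log 2 := Real.log_pos (by norm_num)
  have hc : 0 < (1 + ε) / Real.log 2 := by positivity
  have h := (Real.isLittleO_log_id_atTop.comp_tendsto tendsto_natCast_atTop_atTop).bound
    (inv_pos.2 hc)
  filter_upwards [h] with N hN
  simp only [Function.comp_apply, id_eq, Real.norm_eq_abs, Nat.abs_cast] at hN
  have h1 := numSteps_le ε hε N
  have h2 : (1 + ε) / Real.log 2 * Real.log N ≤ N := by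
    calc (1 + ε) / Real.log 2 * Real.log N
        ≤ (1 + ε) / Real.log 2 * (((1 + ε) / Real.log 2)⁻¹ * N) := by
          gcongr
          exact (le_abs_self _).trans hN
      _ = N := by rw [mul_inv_cancel_left₀ hc.ne']
  exact_mod_cast h1.trans h2

lemma tendsto_mul_half_pow_numSteps (ε : ℝ) (hε : 0 < ε) :
    Tendsto (fun N : ℕ => (N : ℝ) * (1 / 2) ^ numSteps ε N) atTop (𝓝 0) := by
  have h : Tendsto (fun N : ℕ => 2 * (N : ℝ) ^ (-ε)) atTop (𝓝 0) := by
    simpa using ((tendsto_rpow_neg_atTop hε).comp tendsto_natCast_atTop_atTop).const_mul 2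
  refine squeeze_zero' (Eventually.of_forall fun N => by positivity) ?_ h
  filter_upwards [eventually_gt_atTop 0] with N hN
  have hNr : (0 : ℝ) < N := by exact_mod_cast hN
  have h1 : (1 + ε) * Real.logb 2 N - 1 ≤ numSteps ε N := (Nat.sub_one_lt_floor _).le
  have h2 : (1 / 2 : ℝ) ^ numSteps ε N = 2 ^ (-(numSteps ε N : ℝ)) := by
    rw [Real.rpow_neg (by norm_num), Real.rpow_natCast, one_div, inv_pow]
  have h3 : (2 : ℝ) ^ (-(numSteps ε N : ℝ)) ≤ 2 ^ (Real.logb 2 N * (-(1 + ε)) + 1) :=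
    Real.rpow_le_rpow_of_exponent_le (by norm_num) (by linarith)
  rw [Real.rpow_add (by norm_num), Real.rpow_mul (by norm_num),
    Real.rpow_logb (by norm_num) (by norm_num) hNr, Real.rpow_one] at h3
  rw [h2]
  calc (N : ℝ) * 2 ^ (-(numSteps ε N : ℝ)) ≤ N * (N ^ (-(1 + ε)) * 2) := by gcongr
    _ = 2 * (N ^ (1 : ℝ) * N ^ (-(1 + ε))) := by rw [Real.rpow_one]; ring
    _ = 2 * N ^ (-ε) := by
      rw [← Real.rpow_add hNr]
      congr 2
      ring

/-- The number of steps is logarithmic, so the Chebyshev deviation is of order N against a variance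
of order N. -/
lemma tendsto_termination_bound (ε : ℝ) (hε : 0 < ε) :
    Tendsto (fun N : ℕ => 8 * (N : ℝ) / (2 * N - (numSteps ε N + 1)) ^ 2) atTop (𝓝 0) := by
  have h : Tendsto (fun N : ℕ => 32 / (N : ℝ)) atTop (𝓝 0) :=
    tendsto_const_div_atTop_nhds_zero_nat 32
  refine squeeze_zero' (Eventually.of_forall fun N => by positivity) ?_ h
  filter_upwards [eventually_ge_atTop 2, eventually_numSteps_le ε hε] with N hN hK
  have hNr : (2 : ℝ) ≤ N := by exact_mod_cast hN
  have hKr : (numSteps ε N : ℝ) ≤ N := by exact_mod_cast hK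
  have h1 : ((N : ℝ) / 2) ^ 2 ≤ (2 * N - (numSteps ε N + 1)) ^ 2 :=
    pow_le_pow_left₀ (by positivity) (by linarith) 2
  have h2 : (0 : ℝ) < (N / 2) ^ 2 := by positivity
  calc 8 * (N : ℝ) / (2 * N - (numSteps ε N + 1)) ^ 2 ≤ 8 * N / ((N : ℝ) / 2) ^ 2 := by gcongr
    _ = 32 / (N : ℝ) := by
      field_simp
      norm_num

/-- The exponential equals e / (log N)², and one of the two logarithms absorbs the number of steps.
-/
lemma tendsto_miss_bound (ε : ℝ) (hε : 0 < ε) :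
    Tendsto (fun N : ℕ => (numSteps ε N : ℝ) *
      (2 * Real.exp (1 - 2 * Real.log (Real.log N)))) atTop (𝓝 0) := by
  have hlog : Tendsto (fun N : ℕ => Real.log N) atTop atTop :=
    Real.tendsto_log_atTop.comp tendsto_natCast_atTop_atTop
  have h : Tendsto (fun N : ℕ => (1 + ε) / Real.log 2 * 2 * Real.exp 1 * (Real.log N)⁻¹)
      atTop (𝓝 0) := by
    simpa using (tendsto_inv_atTop_zero.comp hlog).const_mul
      ((1 + ε) / Real.log 2 * 2 * Real.exp 1)
  refine squeeze_zero' (Eventually.of_forall fun N => by positivity) ?_ h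
  filter_upwards [hlog.eventually_gt_atTop 0] with N hN
  have h1 : Real.exp (1 - 2 * Real.log (Real.log N)) = Real.exp 1 / Real.log N ^ 2 := by
    rw [Real.exp_sub, mul_comm, Real.exp_mul, Real.exp_log hN]
    norm_num
  rw [h1]
  calc (numSteps ε N : ℝ) * (2 * (Real.exp 1 / Real.log N ^ 2))
      ≤ (1 + ε) / Real.log 2 * Real.log N * (2 * (Real.exp 1 / Real.log N ^ 2)) := by
        gcongr
        exact numSteps_le ε hε N
    _ = _ := by field_simp

lemma tendsto_card_blocks {n k : ℕ → ℕ} (hn : ∀ l, 0 < n l) (hk : ∀ l, 0 < k l)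
    (hkn : ∀ l, k l ∣ n l) (h : Tendsto (fun l => (k l : ℝ) / n l) atTop (𝓝 0)) :
    Tendsto (fun l => n l / k l) atTop atTop := by
  rw [← tendsto_natCast_atTop_iff (R := ℝ)]
  have h1 : Tendsto (fun l => (k l : ℝ) / n l) atTop (𝓝[>] 0) :=
    tendsto_nhdsWithin_iff.2 ⟨h, Eventually.of_forall fun l => by
      have := hn l
      have := hk l
      simp only [Set.mem_Ioi]
      positivity⟩
  refine (tendsto_inv_nhdsGT_zero.comp h1).congr fun l => ?_
  rw [Function.comp_apply, inv_div, Nat.cast_div (hkn l) (by exact_mod_cast (hk l).ne')]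

/-- If a batch separates the two hypotheses for one row, with an error that is negligible compared
to the number of steps, then the risk tends to zero. -/
lemma tendsto_risk_modifiedST {ε : ℝ} (hε : 0 < ε) {n k M : ℕ → ℕ} {ρ : ℕ → ℝ}
    (hρ : ∀ l, 0 < ρ l) (hN : Tendsto (fun l => n l / k l) atTop atTop)
    (hρ0 : Tendsto ρ atTop (𝓝 0))
    (h : ∀ᶠ l in atTop, sqAffinity (keep (k l) (ρ l)) (ρ l) ^
      batch (n l) (k l) (M l) (keep (k l) (ρ l)) ≤
        Real.exp (1 - 2 * Real.log (Real.log (n l / k l : ℕ)))) :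
    Tendsto (fun l => (modifiedST (n l) (k l) (M l) (ρ l) ε).risk (ρ l)
      (disjointIntervals (n l) (k l))) atTop (𝓝 0) := by
  have hof : ∀ {f : ℕ → ℝ}, Tendsto f atTop (𝓝 0) →
      Tendsto (fun l => ENNReal.ofReal (f (n l / k l))) atTop (𝓝 0) := fun hf => by
    simpa using ENNReal.tendsto_ofReal (hf.comp hN)
  have hlim := (hof (tendsto_mul_half_pow_numSteps ε hε)).add
    ((hof (tendsto_termination_bound ε hε)).add (hof (tendsto_miss_bound ε hε)))
  simp only [add_zero] at hlim
  refine tendsto_of_tendsto_of_tendsto_of_le_of_le' tendsto_const_nhds hlim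
    (Eventually.of_forall fun l => zero_le) ?_
  filter_upwards [h, hρ0.eventually_lt_const one_pos, hN.eventually (eventually_ge_atTop 2),
    hN.eventually (eventually_numSteps_le ε hε)] with l hl hl1 hN2 hK
  refine (risk_modifiedST_le (hρ l).le hl1 (mul_batch_le _ hK) (by lia)).trans ?_
  gcongr

end Asymptotics

end CorrDetect

theorem proposition3 :
    ∃ C₅ C₆ : ℝ, 0 < C₅ ∧ 0 < C₆ ∧
      ∀ (ε : ℝ), 0 < ε →
      ∀ (n k M : ℕ → ℕ) (ρ : ℕ → ℝ),
        (∀ l, 0 < n l) → (∀ l, 0 < k l) → (∀ l, k l ∣ n l) → (∀ l, 0 < ρ l) →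
        Tendsto n atTop atTop → Tendsto k atTop atTop →
        Tendsto (fun l => (k l : ℝ) / n l) atTop (𝓝 0) →
        Tendsto ρ atTop (𝓝 0) →
        ((Tendsto (fun l => ρ l * k l) atTop atTop ∧
            ∀ᶠ l in atTop,
              C₅ * Real.log (Real.log ((n l : ℝ) / k l)) ≤ ρ l * k l * ((M l : ℝ) / n l)) ∨
          (Tendsto (fun l => ρ l * k l) atTop (𝓝 0) ∧
            ∀ᶠ l in atTop,
              C₆ * √(Real.log (Real.log ((n l : ℝ) / k l))) ≤
                ρ l * k l * √((M l : ℝ) / n l))) →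
        (∀ l, (CorrDetect.modifiedST (n l) (k l) (M l) (ρ l) ε).IsAdmissible) ∧
        Tendsto
          (fun l => (CorrDetect.modifiedST (n l) (k l) (M l) (ρ l) ε).risk (ρ l)
            (CorrDetect.disjointIntervals (n l) (k l)))
          atTop (𝓝 0) := by
  refine ⟨2048, 32, by norm_num, by norm_num, fun ε hε n k M ρ hn hk hkn hρ _ hkt hkn0 hρ0 h =>
    ⟨fun l => CorrDetect.isAdmissible_modifiedST _ _ _ _ _, ?_⟩⟩
  have hN := CorrDetect.tendsto_card_blocks hn hk hkn hkn0
  have hcast : ∀ l, ((n l / k l : ℕ) : ℝ) = n l / k l := fun l =>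
    Nat.cast_div (hkn l) (by exact_mod_cast (hk l).ne')
  refine CorrDetect.tendsto_risk_modifiedST hε hρ hN hρ0 ?_
  simp_rw [hcast]
  rcases h with ⟨hd, hC⟩ | ⟨hs, hC⟩
  · filter_upwards [hC, hd.eventually_ge_atTop 1,
      hρ0.eventually_le_const (show (0 : ℝ) < 1 / 2 by norm_num)] with l hl h1 h2
    exact CorrDetect.sqAffinity_pow_le_of_dense (hn l) (hkn l) (hρ l) h2 h1 hl
  -- The iterated logarithm must be nonnegative for the square-root condition to be squared.
  · have hlog : Tendsto (fun l => Real.log (Real.log ((n l : ℝ) / k l))) atTop atTop := by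
      simp_rw [← hcast]
      exact Real.tendsto_log_atTop.comp (Real.tendsto_log_atTop.comp
        (tendsto_natCast_atTop_atTop.comp hN))
    filter_upwards [hC, hs.eventually_le_const one_pos, hkt.eventually_ge_atTop 2,
      hlog.eventually_ge_atTop 0] with l hl h1 h2 h3
    exact CorrDetect.sqAffinity_pow_le_of_sparse (hn l) (hkn l) h2 (hρ l) h1 h3 hl
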